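/- **Exact loading of discrete IQP states from quantum access.** Let $N\ge 2$ and $D$ be natural numbers and $0<\delta<1$. For a simple graph on the $N$ qubits with edge set $E\ne\varnothing$ and maximum degree at most $D$, consider the IQP state $$|v(E)\rangle = H^{\otimes N}\Big(\prod_{\{i,j\}\in E} e^{-i\pi Z_iZ_j/8}\Big)H^{\otimes N}|0^N\rangle .$$ The graph is unknown, and $|v(E)\rangle$ is accessible only through copies: one call takes one copy, applies a circuit of gate blocks and measures a Pauli observable on one qubit. The algorithm AQER, with $M$ shots per estimate and an iteration budget $B$, is the following. *Step I.* Let $V_{t}\cdots V_1$ be the blocks found so far. For each pair $p<q$ and each angle $\alpha\in\{0,-\pi/4\}$ the candidate block on $\{p,q\}$ is $e^{-i\alpha Z_pZ_q/2}$ preceded by $R_Z(\pi)R_Y(-\pi/2)=-iH$ on each of $p,q$ that no earlier block has acted on. For $n\in\{p,q\}$ the Pauli expectation $x_n$ of $X_n$ in the state after the candidate is replaced by the empirical mean $\hat x_n$ of $M$ measurements, each on a fresh copy, and the Rényi-2 entropy of qubit $n$ by $-\log_2\frac{1+\hat x_n^2}{2}$. The sum of the two entropies at $\alpha=-\pi/4$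 minus that at $\alpha=0$ estimates the change of the entanglement measure $\mathcal S=\sum_{n}\mathcal S_{\{n\}}$ (the sum of the single-qubit Rényi-2 entropies). The candidate of angle $-\pi/4$ with the smallest estimated change is appended as $V_{t+1}$ if this change is negative; otherwise, or when $B$ blocks have been appended, Step I stops. Let $T$ be the number of blocks appended and $V=V_T\cdots V_1$. *Step II.* The output is the circuit $U=V^\dagger\bigotimes_{n} R_Z(\beta_n)R_Y(\gamma_n)$ where $R_Z(\beta_n)R_Y(\gamma_n)|0\rangle$ is the pure state $|+\rangle$ if Step I has acted on qubit $n$ and $|0\rangle$ if not, with $\beta_n=\arg\rho_{10}$ and $\gamma_n=\frac{\pi}{2}-\arcsin\frac{\rho_{00}-\rho_{11}}{\sqrt{4|\rho_{10}|^2+(\rho_{00}-\rho_{11})^2}}$ computed from the density matrix $\rho$ of that pure state. There is a universal constant $C>0$ such that for all $N,D,\delta$ as above there is a number of shots $M$, depending only on $N,D,\delta$, with the following property. For every budget $B$ and every graph as above with $1\le|E|\le B$ (for instance $B=\binom N2$ if nothing is known about $|E|$, or $B=|E|$), with probability at least $1-\delta$ all of the following hold: * $U|0^N\rangle=|v(E)\rangle$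 up to a global phase; * $T\le|E|$; * the number of copies of $|v(E)\rangle$ used is at most $C\,|E|\,N^2\,2^D\log\frac{N^2|E|}{\delta}$. Moreover every run satisfies $T\le B$ and uses at most $C\,B\,N^2\,2^D\log\frac{N^2B}{\delta}$ copies; for $B=|E|$ the stated bounds on $T$ and on the number of copies therefore hold with certainty. -/

import Mathlib

open scoped Matrix

noncomputable section

namespace AQER

/-! ### Qubits, Pauli operators and rotation gates -/

/-- Vectors of the `N`-qubit space, in the computational basis `|x⟩`, `x : Fin N → Fin 2`. -/
abbrev Ket (N : ℕ) : Type := (Fin N → Fin 2) → ℂ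

/-- Linear operators of the `N`-qubit space, as matrices in the computational basis. -/
abbrev Op (N : ℕ) : Type := Matrix (Fin N → Fin 2) (Fin N → Fin 2) ℂ

/-- The computational basis state `|0⟩^{⊗N}`. -/
def ketZero (N : ℕ) : Ket N := Pi.single 0 1

def pauliX : Matrix (Fin 2) (Fin 2) ℂ := !![0, 1; 1, 0]

def pauliY : Matrix (Fin 2) (Fin 2) ℂ := !![0, -Complex.I; Complex.I, 0]

def pauliZ : Matrix (Fin 2) (Fin 2) ℂ := !![1, 0; 0, -1]

def hadamard : Matrix (Fin 2) (Fin 2) ℂ := ((1 / Real.sqrt 2 : ℝ) : ℂ) • !![1, 1; 1, -1]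

/-- The operator acting as the one-qubit operator `A` on qubit `n` and as the identity on all the
other qubits. -/
def onQubit {N : ℕ} (n : Fin N) (A : Matrix (Fin 2) (Fin 2) ℂ) : Op N :=
  Matrix.of fun x y => if ∀ k, k ≠ n → x k = y k then A (x n) (y n) else 0

/-- The rotation `R_σ(θ) = exp (-i θ σ / 2)` generated by `σ`. -/
def rot {N : ℕ} (σ : Op N) (θ : ℝ) : Op N :=
  NormedSpace.exp ((-(Complex.I * (θ : ℂ) / 2)) • σ)

/-- `R_Y(θ)` on qubit `n`. -/
def RY {N : ℕ} (n : Fin N) (θ : ℝ) : Op N := rot (onQubit n pauliY) θ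

/-- `R_Z(θ)` on qubit `n`. -/
def RZ {N : ℕ} (n : Fin N) (θ : ℝ) : Op N := rot (onQubit n pauliZ) θ

/-- `R_ZZ(θ) = exp (-i θ Z_p Z_q / 2)` on the qubits `p` and `q`. -/
def RZZ {N : ℕ} (p q : Fin N) (θ : ℝ) : Op N := rot (onQubit p pauliZ * onQubit q pauliZ) θ

/-- `A^{⊗N}` applied qubit by qubit (the factors commute). -/
def onAll {N : ℕ} (A : Fin N → Op N) : Op N := ((List.finRange N).map A).prod

/-- All pairs `(p, q)` of qubits with `p < q`, each once. -/
def pairs (N : ℕ) : List (Fin N × Fin N) :=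
  ((List.finRange N).product (List.finRange N)).filter fun e => e.1 < e.2

/-! ### The target states -/

/-- The IQP state of the graph `G`, all angles being `π / 4`:
`H^{⊗N} (∏_{{p,q} ∈ E} exp (-i π Z_p Z_q / 8)) H^{⊗N} |0^N⟩` (the gates of the product commute). -/
def iqpState {N : ℕ} (G : SimpleGraph (Fin N)) [DecidableRel G.Adj] : Ket N :=
  (onAll (fun n => onQubit n hadamard)
    * (((pairs N).filter fun e => G.Adj e.1 e.2).map fun e => RZZ e.1 e.2 (Real.pi / 4)).prod
    * onAll (fun n => onQubit n hadamard)) *ᵥ ketZero N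

/-! ### Measuring one copy of a state -/

/-- The squared Euclidean norm of a vector. -/
def sqNorm {N : ℕ} (ψ : Ket N) : ℝ := ∑ x, ‖ψ x‖ ^ 2

inductive Pauli
  | X | Y | Z

def Pauli.mat : Pauli → Matrix (Fin 2) (Fin 2) ℂ
  | X => pauliX
  | Y => pauliY
  | Z => pauliZ

/-- `‖Π ψ‖²`, with `Π = (1 ± P_n) / 2` the projection to the eigenspace of the Pauli observable
`P` on qubit `n` for the eigenvalue `+1` (`b = true`) or `-1` (`b = false`). -/
def bornWeight {N : ℕ} (ψ : Ket N) (P : Pauli) (n : Fin N) (b : Bool) : ℝ :=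
  sqNorm (((1 / 2 : ℂ) • (1 + (if b then (1 : ℂ) else -1) • onQubit n P.mat)) *ᵥ ψ)

/-- The Born probability of the outcome `+1`. For a unit vector the denominator is `1`. -/
def probPlus {N : ℕ} (ψ : Ket N) (P : Pauli) (n : Fin N) : ℝ :=
  bornWeight ψ P n true / (bornWeight ψ P n true + bornWeight ψ P n false)

theorem bornWeight_nonneg {N : ℕ} (ψ : Ket N) (P : Pauli) (n : Fin N) (b : Bool) :
    0 ≤ bornWeight ψ P n b :=
  Finset.sum_nonneg fun _ _ => by positivity

theorem probPlus_nonneg {N : ℕ} (ψ : Ket N) (P : Pauli) (n : Fin N) : 0 ≤ probPlus ψ P n :=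
  div_nonneg (bornWeight_nonneg ..) (add_nonneg (bornWeight_nonneg ..) (bornWeight_nonneg ..))

theorem probPlus_le_one {N : ℕ} (ψ : Ket N) (P : Pauli) (n : Fin N) : probPlus ψ P n ≤ 1 :=
  div_le_one_of_le₀ (le_add_of_nonneg_right (bornWeight_nonneg ..))
    (add_nonneg (bornWeight_nonneg ..) (bornWeight_nonneg ..))

/-- The random outcome (`true` for `+1`, `false` for `-1`) of measuring the Pauli observable `P` on
qubit `n` of one copy of `ψ`. -/
def shot {N : ℕ} (ψ : Ket N) (P : Pauli) (n : Fin N) : PMF Bool :=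
  PMF.ofFintype
    (fun b => ENNReal.ofReal (if b then probPlus ψ P n else 1 - probPlus ψ P n)) (by
      have h0 := probPlus_nonneg ψ P n
      have h1 := probPlus_le_one ψ P n
      rw [Fintype.sum_bool]
      simp only [if_true, Bool.false_eq_true, if_false]
      rw [← ENNReal.ofReal_add h0 (by linarith)]
      simp)

/-! ### Two-qubit gate blocks and circuits -/

/-- A gate block of AQER: a pair of distinct qubits `p`, `q`, the angle of `R_ZZ`, and for each of
the two qubits the angles of its `R_Z` and `R_Y`. -/
structure Block (N : ℕ) where
  p : Fin N
  q : Fin N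
  ne : p ≠ q
  zz : ℝ
  zp : ℝ
  yp : ℝ
  zq : ℝ
  yq : ℝ

/-- The unitary of a block: single-qubit rotations `R_Z R_Y` on both qubits, followed by `R_ZZ`. -/
def Block.op {N : ℕ} (b : Block N) : Op N :=
  RZZ b.p b.q b.zz * ((RZ b.p b.zp * RY b.p b.yp) * (RZ b.q b.zq * RY b.q b.yq))

/-- `V_t ⋯ V_1` for the list `[V_1, …, V_t]` of blocks (the head is applied first). -/
def blocksOp {N : ℕ} (c : List (Block N)) : Op N := ((c.map Block.op).reverse).prod

/-- A loading circuit of AQER: the blocks of Step I and the angles of Step II. -/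
structure Loader (N : ℕ) where
  blocks : List (Block N)
  β : Fin N → ℝ
  γ : Fin N → ℝ

/-- `U = V_T† W(β, γ)` with `W(β, γ) = ⊗_n R_Z(β_n) R_Y(γ_n)`. -/
def Loader.op {N : ℕ} (L : Loader N) : Op N :=
  (blocksOp L.blocks)ᴴ * onAll fun n => RZ n (L.β n) * RY n (L.γ n)

/-- `U |0^N⟩ = ψ` up to a global phase. -/
def Loader.LoadsExactly {N : ℕ} (L : Loader N) (ψ : Ket N) : Prop :=
  ∃ g : ℝ, L.op *ᵥ ketZero N = Complex.exp (-(Complex.I * (g : ℂ))) • ψ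

/-! ### Algorithms with quantum access to an unknown state -/

/-- An adaptive algorithm whose only access to an unknown `N`-qubit state is to take a fresh copy,
run a circuit of blocks on it and measure a Pauli observable on one qubit. Everything it does later
may depend on the outcomes. It finally returns an element of `α`. -/
inductive CopyAlg (N : ℕ) (α : Type) : Type
  | done (a : α) : CopyAlg N α
  | measure (c : List (Block N)) (P : Pauli) (n : Fin N) (next : Bool → CopyAlg N α) : CopyAlg N α

namespace CopyAlg

/-- Sequential composition. -/
def bind {N : ℕ} {α β : Type} : CopyAlg N α → (α → CopyAlg N β) → CopyAlg N β
  | done a, f => f a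
  | measure c P n next, f => measure c P n fun b => (next b).bind f

/-- The joint law of the returned value and of the number of copies used, when the unknown state
is `ψ`. -/
def run {N : ℕ} {α : Type} (ψ : Ket N) : CopyAlg N α → PMF (α × ℕ)
  | done a => PMF.pure (a, 0)
  | measure c P n next =>
      (shot (blocksOp c *ᵥ ψ) P n).bind fun b =>
        ((next b).run ψ).map fun r => (r.1, r.2 + 1)

end CopyAlg

/-! ### The algorithm AQER for these states -/

/-- The Rényi-2 entropy `-log₂ Tr ρ²` of a one-qubit density matrix. -/
def renyi (ρ : Matrix (Fin 2) (Fin 2) ℂ) : ℝ := -Real.logb 2 (ρ * ρ).trace.re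

/-- The one-qubit matrix with Bloch vector `(x, 0, 0)`. -/
def blochX (x : ℝ) : Matrix (Fin 2) (Fin 2) ℂ := (1 / 2 : ℂ) • (1 + (x : ℂ) • pauliX)

/-- The sum of the `±1` outcomes of `M` measurements of `X` on qubit `n` after the circuit `c`. -/
def outcomeSum {N : ℕ} (c : List (Block N)) (n : Fin N) : ℕ → CopyAlg N ℝ
  | 0 => .done 0
  | M + 1 => .measure c .X n fun b =>
      (outcomeSum c n M).bind fun s => .done (s + if b then 1 else -1)

/-- Estimate of the Rényi-2 entropy of qubit `n` after the circuit `c` from `M` copies: the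
Bloch component `x_n` is replaced by an empirical mean (`y_n = z_n = 0` for the states at hand). -/
def entropyEst {N : ℕ} (M : ℕ) (c : List (Block N)) (n : Fin N) : CopyAlg N ℝ :=
  (outcomeSum c n M).bind fun s => .done (renyi (blochX (s / M)))

/-- Qubit `n` is acted on by some block of `c`. -/
def Touched {N : ℕ} (c : List (Block N)) (n : Fin N) : Prop := ∃ b ∈ c, b.p = n ∨ b.q = n

open Classical in
/-- The candidate block on the pair `p`, `q` with `R_ZZ` angle `θ`, after the blocks `c`: the
single-qubit part is `R_Z(0) R_Y(0) = 1` on a qubit touched before, and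
`R_Z(π) R_Y(-π/2) = -i H` on a fresh one. -/
def candidate {N : ℕ} (c : List (Block N)) (p q : Fin N) (h : p ≠ q) (θ : ℝ) : Block N where
  p := p
  q := q
  ne := h
  zz := θ
  zp := if Touched c p then 0 else Real.pi
  yp := if Touched c p then 0 else -(Real.pi / 2)
  zq := if Touched c q then 0 else Real.pi
  yq := if Touched c q then 0 else -(Real.pi / 2)

/-- Estimate of the change of the entanglement measure `S = ∑ n, S_n` when the angle of the
candidate block on `p`, `q` is switched from `0` to `-π/4`. Only the entropies of `p` and `q` are
affected, and each of the four entropies involved is estimated from `M` copies. At angle `0` the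
block does not change `S`. -/
def changeEst {N : ℕ} (M : ℕ) (c : List (Block N)) (p q : Fin N) (h : p ≠ q) : CopyAlg N ℝ :=
  let c₀ := c ++ [candidate c p q h 0]
  let c₁ := c ++ [candidate c p q h (-(Real.pi / 4))]
  (entropyEst M c₀ p).bind fun a₀ => (entropyEst M c₀ q).bind fun b₀ =>
  (entropyEst M c₁ p).bind fun a₁ => (entropyEst M c₁ q).bind fun b₁ =>
  .done ((a₁ + b₁) - (a₀ + b₀))

/-- The candidate blocks of angle `-π/4` on the pairs of a list, with the estimated changes
of `S`. -/
def scan {N : ℕ} (M : ℕ) (c : List (Block N)) :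
    List (Fin N × Fin N) → CopyAlg N (List (Block N × ℝ))
  | [] => .done []
  | e :: l =>
      if h : e.1 ≠ e.2 then
        (changeEst M c e.1 e.2 h).bind fun v =>
        (scan M c l).bind fun r => .done ((candidate c e.1 e.2 h (-(Real.pi / 4)), v) :: r)
      else scan M c l

/-- Step I with at most the given number of iterations, starting after the blocks `c`. One iteration
is a grid search over all pairs and the angles `0`, `-π/4` for the minimum of the estimate of `S`. It
appends the minimizing block; the algorithm stops when the minimum is attained at angle `0`, that
is, when no candidate of angle `-π/4` lowers the estimate. -/
def stepI {N : ℕ} (M : ℕ) : ℕ → List (Block N) → CopyAlg N (List (Block N))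
  | 0, c => .done c
  | k + 1, c => (scan M c (pairs N)).bind fun r =>
      match r.argmin Prod.snd with
      | none => .done c
      | some (b, v) => if v < 0 then stepI M k (c ++ [b]) else .done c

/-- The angle `β = arg ρ₁₀` of the pure state `R_Z(β) R_Y(γ) |0⟩` closest to `ρ`. -/
def betaAngle (ρ : Matrix (Fin 2) (Fin 2) ℂ) : ℝ := (ρ 1 0).arg

/-- The angle `γ` of the pure state `R_Z(β) R_Y(γ) |0⟩` closest to `ρ`. -/
def gammaAngle (ρ : Matrix (Fin 2) (Fin 2) ℂ) : ℝ :=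
  Real.pi / 2 - Real.arcsin (((ρ 0 0).re - (ρ 1 1).re) /
    Real.sqrt (4 * ‖ρ 1 0‖ ^ 2 + ((ρ 0 0).re - (ρ 1 1).re) ^ 2))

open Classical in
/-- The one-qubit density matrix that Step II assumes after Step I: `|+⟩⟨+|` on the qubits that
Step I has touched, `|0⟩⟨0|` on the others. -/
def residual {N : ℕ} (c : List (Block N)) (n : Fin N) : Matrix (Fin 2) (Fin 2) ℂ :=
  if Touched c n then blochX 1 else !![1, 0; 0, 0]

/-- AQER on `N` qubits, with `M` shots per estimated expectation value and an iteration budget `B`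
for Step I. Step II needs no further copies. -/
def aqer (N M B : ℕ) : CopyAlg N (Loader N) :=
  (stepI M B []).bind fun c =>
    .done ⟨c, fun n => betaAngle (residual c n), fun n => gammaAngle (residual c n)⟩

end AQER

end

open scoped Matrix

noncomputable section

namespace AQER

/-! ### Rotations generated by involutions -/

/-! Up to a global phase, a correct run keeps the state in the form "Hadamards on the untouched
qubits, applied to a weighted graph state with coupling π/4 on the edges of a remaining graph R"
(`Reaches` with `graphWeight R`). Initially R = G. A candidate block on p, q first cancels the
Hadamards on its fresh qubits, and its R_ZZ(θ) then adds θ to the coupling of p and q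
(`Reaches.append_candidate`). Angle -π/4 on an edge of R therefore deletes that edge.

Edges are visible in the entropies because a weighted graph state has ⟨X_n⟩ = ∏_k cos w_nk
(`bornWeight_phaseKet`). Changing the angle from 0 to -π/4 turns the factor of the pair from √2/2
into 1 on an edge, and from 1 into √2/2 on a non-edge, at both qubits. The other factors multiply to
at least r = (√2/2)^D, so the gap exceeds r/4 and accuracy r/8 in every mean fixes the sign of the
estimated change (`Reaches.failure_changeEst_le`). Hence, while all estimates are accurate, each
iteration removes one edge, Step I stops exactly when R is empty, after |E| blocks, and the
remaining product state is the one Step II prepares (`Reaches.loadsExactly`).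

Hoeffding's inequality bounds the failure of one estimate by 2 exp(-M 2^(-D)/128). A union bound
over the at most 4 N^4 estimates of a correct run gives total failure at most δ for M of order 2^D
log(N²/δ) (`hoeffdingBound_shots_le`). The copy count is deterministic once the number of blocks is
known (`allRuns_aqer`), so only correctness is a probabilistic statement. -/

theorem rot_of_mul_self {N : ℕ} (σ : Op N) (hσ : σ * σ = 1) (θ : ℝ) :
    rot σ θ = (Real.cos (θ / 2) : ℂ) • (1 : Op N)
      - (Complex.I * (Real.sin (θ / 2) : ℂ)) • σ := by
  let _ : NormedRing (Op N) := Matrix.linftyOpNormedRing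
  let _ : NormedAlgebra ℂ (Op N) := Matrix.linftyOpNormedAlgebra
  -- The complementary projections (1 ± σ)/2 are orthogonal idempotents, so (a, b) ↦ a(1+σ)/2 +
  -- b(1-σ)/2 is a continuous ring homomorphism. It commutes with exp, which on ℂ × ℂ is computed
  -- coordinatewise on the two eigenvalues.
  let f : ℂ × ℂ →+* Op N :=
    { toFun := fun a => ((a.1 + a.2) / 2) • (1 : Op N) + ((a.1 - a.2) / 2) • σ
      map_one' := by simp
      map_zero' := by simp
      map_add' := fun a b => by
        simp only [Prod.fst_add, Prod.snd_add]
        module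
      map_mul' := fun a b => by
        simp only [Prod.fst_mul, Prod.snd_mul, add_mul, mul_add, smul_mul_smul_comm, one_mul,
          mul_one, hσ]
        module }
  have hf : Continuous f := by
    change Continuous fun a : ℂ × ℂ =>
      ((a.1 + a.2) / 2) • (1 : Op N) + ((a.1 - a.2) / 2) • σ
    fun_prop
  have key := NormedSpace.map_exp f hf
    (-(Complex.I * (θ : ℂ) / 2), (Complex.I * (θ : ℂ) / 2))
  have h1 : f (-(Complex.I * (θ : ℂ) / 2), (Complex.I * (θ : ℂ) / 2))
      = (-(Complex.I * (θ : ℂ) / 2)) • σ := by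
    change ((_ + _) / 2 : ℂ) • (1 : Op N) + ((_ - _) / 2 : ℂ) • σ = _
    simp only
    module
  rw [h1] at key
  refine key.symm.trans ?_
  change ((_ + _) / 2 : ℂ) • (1 : Op N) + ((_ - _) / 2 : ℂ) • σ = _
  rw [Prod.fst_exp, Prod.snd_exp]
  simp only [← Complex.exp_eq_exp_ℂ]
  have e1 : -(Complex.I * (θ : ℂ) / 2) = ((-(θ / 2) : ℝ) : ℂ) * Complex.I := by push_cast; ring
  have e2 : (Complex.I * (θ : ℂ) / 2) = ((θ / 2 : ℝ) : ℂ) * Complex.I := by push_cast; ring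
  rw [e1, e2, Complex.exp_mul_I, Complex.exp_mul_I, ← Complex.ofReal_cos, ← Complex.ofReal_sin,
    ← Complex.ofReal_cos, ← Complex.ofReal_sin, Real.cos_neg, Real.sin_neg]
  push_cast
  module

/-! ### Tensor products of one-qubit operators -/

/-- The tensor product `⨂ n, A n`. -/
def tensor {N : ℕ} (A : Fin N → Matrix (Fin 2) (Fin 2) ℂ) : Op N :=
  Matrix.of fun x y => ∏ n, A n (x n) (y n)

/-- The product vector `⨂ n, v n`. -/
def prodKet {N : ℕ} (v : Fin N → Fin 2 → ℂ) : Ket N := fun x => ∏ n, v n (x n)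

theorem tensor_mul {N : ℕ} (A B : Fin N → Matrix (Fin 2) (Fin 2) ℂ) :
    tensor A * tensor B = tensor fun n => A n * B n := by
  ext x y
  simp only [tensor, Matrix.mul_apply, Matrix.of_apply, ← Finset.prod_mul_distrib]
  exact (Fintype.prod_sum fun n b => A n (x n) b * B n b (y n)).symm

theorem tensor_mulVec_prodKet {N : ℕ} (A : Fin N → Matrix (Fin 2) (Fin 2) ℂ)
    (v : Fin N → Fin 2 → ℂ) : tensor A *ᵥ prodKet v = prodKet fun n => A n *ᵥ v n := by
  ext x
  simp only [tensor, prodKet, Matrix.mulVec, dotProduct, Matrix.of_apply,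
    ← Finset.prod_mul_distrib]
  exact (Fintype.prod_sum fun n b => A n (x n) b * v n b).symm

theorem tensor_conjTranspose {N : ℕ} (A : Fin N → Matrix (Fin 2) (Fin 2) ℂ) :
    (tensor A)ᴴ = tensor fun n => (A n)ᴴ := by
  ext x y
  simp [tensor, Matrix.conjTranspose_apply]

theorem tensor_one {N : ℕ} : tensor (fun _ : Fin N => 1) = 1 := by
  ext x y
  simp only [tensor, Matrix.of_apply, Matrix.one_apply, Finset.prod_ite_zero, Finset.prod_const_one,
    Finset.mem_univ, true_implies, funext_iff]

theorem tensor_smul {N : ℕ} (g : Fin N → ℂ) (A : Fin N → Matrix (Fin 2) (Fin 2) ℂ) :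
    tensor (fun n => g n • A n) = (∏ n, g n) • tensor A := by
  ext x y
  simp [tensor, Finset.prod_mul_distrib]

/-- Common normal form for local gates: identities between products of them can then be checked one
qubit at a time. -/
theorem onQubit_eq_tensor {N : ℕ} (n : Fin N) (A : Matrix (Fin 2) (Fin 2) ℂ) :
    onQubit n A = tensor fun k => if k = n then A else 1 := by
  ext x y
  simp only [onQubit, tensor, Matrix.of_apply]
  rw [← Finset.mul_prod_erase _ _ (Finset.mem_univ n), if_pos rfl]
  have : ∏ k ∈ Finset.univ.erase n, (if k = n then A else 1) (x k) (y k)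
      = ∏ k ∈ Finset.univ.erase n, if x k = y k then (1 : ℂ) else 0 :=
    Finset.prod_congr rfl fun k hk => by rw [if_neg (Finset.ne_of_mem_erase hk), Matrix.one_apply]
  rw [this, Finset.prod_ite_zero]
  simp

theorem onQubit_one {N : ℕ} (n : Fin N) : onQubit n 1 = 1 := by
  rw [onQubit_eq_tensor, ← tensor_one]
  simp

theorem onQubit_mul {N : ℕ} (n : Fin N) (A B : Matrix (Fin 2) (Fin 2) ℂ) :
    onQubit n A * onQubit n B = onQubit n (A * B) := by
  simp only [onQubit_eq_tensor, tensor_mul]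
  congr 1
  ext1 k
  split_ifs <;> simp

theorem onQubit_smul {N : ℕ} (n : Fin N) (g : ℂ) (A : Matrix (Fin 2) (Fin 2) ℂ) :
    onQubit n (g • A) = g • onQubit n A := by
  ext x y
  simp [onQubit]

theorem onQubit_sub {N : ℕ} (n : Fin N) (A B : Matrix (Fin 2) (Fin 2) ℂ) :
    onQubit n (A - B) = onQubit n A - onQubit n B := by
  ext x y
  simp only [onQubit, Matrix.of_apply, Matrix.sub_apply]
  split_ifs <;> simp

theorem onQubit_conjTranspose {N : ℕ} (n : Fin N) (A : Matrix (Fin 2) (Fin 2) ℂ) :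
    (onQubit n A)ᴴ = onQubit n Aᴴ := by
  rw [onQubit_eq_tensor, tensor_conjTranspose, onQubit_eq_tensor]
  congr 1
  ext1 k
  split_ifs <;> simp

theorem prod_map_onQubit {N : ℕ} (A : Fin N → Matrix (Fin 2) (Fin 2) ℂ) (l : List (Fin N))
    (hl : l.Nodup) :
    (l.map fun n => onQubit n (A n)).prod = tensor fun n => if n ∈ l then A n else 1 := by
  induction l with
  | nil => simp [tensor_one]
  | cons a l ih =>
    rw [List.nodup_cons] at hl
    rw [List.map_cons, List.prod_cons, ih hl.2, onQubit_eq_tensor, tensor_mul]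
    congr 1
    ext1 k
    by_cases h : k = a
    · subst h
      simp [hl.1]
    · simp [h]

theorem onAll_onQubit {N : ℕ} (A : Fin N → Matrix (Fin 2) (Fin 2) ℂ) :
    onAll (fun n => onQubit n (A n)) = tensor A := by
  rw [onAll, prod_map_onQubit A _ (List.nodup_finRange N)]
  simp

theorem ketZero_eq_prodKet (N : ℕ) : ketZero N = prodKet fun _ => ![1, 0] := by
  ext x
  have h : ∀ b : Fin 2, (![1, 0] : Fin 2 → ℂ) b = if b = 0 then 1 else 0 := by
    intro b
    fin_cases b <;> simp
  simp only [ketZero, prodKet, h, Finset.prod_ite_zero, Pi.single_apply, funext_iff, Pi.zero_apply,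
    Finset.mem_univ, true_implies, Finset.prod_const_one]

/-- A nonzero entry of `tensor A` at (x, y) forces x and y to agree wherever A is the identity, and
d sees only those coordinates. This moves R_ZZ past Hadamards on other qubits. -/
theorem diagonal_commute_tensor {N : ℕ} (d : (Fin N → Fin 2) → ℂ)
    (A : Fin N → Matrix (Fin 2) (Fin 2) ℂ)
    (h : ∀ x y, (∀ n, A n = 1 → x n = y n) → d x = d y) :
    Matrix.diagonal d * tensor A = tensor A * Matrix.diagonal d := by
  ext x y
  rw [Matrix.diagonal_mul, Matrix.mul_diagonal]
  by_cases hxy : tensor A x y = 0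
  · simp [hxy]
  · rw [h x y, mul_comm]
    intro n hn
    by_contra hne
    apply hxy
    exact Finset.prod_eq_zero (Finset.mem_univ n) (by rw [hn, Matrix.one_apply_ne hne])

/-! ### The gates -/

theorem pauliY_mul_self : pauliY * pauliY = 1 := by
  ext i j
  fin_cases i <;> fin_cases j <;> simp [pauliY, Matrix.mul_apply]

theorem pauliZ_mul_self : pauliZ * pauliZ = 1 := by
  ext i j
  fin_cases i <;> fin_cases j <;> simp [pauliZ, Matrix.mul_apply]

theorem hadamard_mul_self : hadamard * hadamard = 1 := by
  have h : ((Real.sqrt 2 : ℝ) : ℂ) * (Real.sqrt 2 : ℝ) = 2 := by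
    rw [← Complex.ofReal_mul, Real.mul_self_sqrt (by norm_num)]
    norm_num
  have h' : ((Real.sqrt 2 : ℝ) : ℂ)⁻¹ * ((Real.sqrt 2 : ℝ) : ℂ)⁻¹ = 1 / 2 := by
    rw [← mul_inv, h]; norm_num
  ext i j
  fin_cases i <;> fin_cases j <;> simp [hadamard, Matrix.mul_apply, h'] <;> norm_num

theorem hadamard_conjTranspose : hadamardᴴ = hadamard := by
  ext i j
  fin_cases i <;> fin_cases j <;> simp [hadamard]

theorem rot_onQubit {N : ℕ} (n : Fin N) (σ : Matrix (Fin 2) (Fin 2) ℂ) (hσ : σ * σ = 1) (θ : ℝ) :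
    rot (onQubit n σ) θ = onQubit n ((Real.cos (θ / 2) : ℂ) • 1
      - (Complex.I * (Real.sin (θ / 2) : ℂ)) • σ) := by
  rw [rot_of_mul_self _ (by rw [onQubit_mul, hσ, onQubit_one]), onQubit_sub, onQubit_smul,
    onQubit_smul, onQubit_one]

theorem RZ_zero_mul_RY_zero {N : ℕ} (n : Fin N) : RZ n 0 * RY n 0 = onQubit n 1 := by
  simp [RZ, RY, rot_onQubit, pauliY_mul_self, pauliZ_mul_self, onQubit_one]

theorem RZ_pi_mul_RY_neg {N : ℕ} (n : Fin N) :
    RZ n Real.pi * RY n (-(Real.pi / 2)) = onQubit n ((-Complex.I) • hadamard) := by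
  have h2 : Real.sqrt 2 / 2 = 1 / Real.sqrt 2 := by
    rw [div_eq_div_iff (by norm_num) (by positivity), Real.mul_self_sqrt (by norm_num)]
    norm_num
  rw [RZ, RY, rot_onQubit n _ pauliZ_mul_self, rot_onQubit n _ pauliY_mul_self, onQubit_mul]
  rw [show -(Real.pi / 2) / 2 = -(Real.pi / 4) by ring, Real.cos_neg, Real.sin_neg,
    Real.cos_pi_div_four, Real.sin_pi_div_four, Real.cos_pi_div_two, Real.sin_pi_div_two, h2]
  congr 1
  ext i j
  fin_cases i <;> fin_cases j <;>
    simp [hadamard, pauliZ, pauliY, Matrix.mul_apply] <;> ring_nf <;> simp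

/-- The eigenvalue of `Z` at a basis state. -/
def sgn (b : Fin 2) : ℝ := if b = 0 then 1 else -1

theorem pauliZ_eq_diagonal : pauliZ = Matrix.diagonal fun b => (sgn b : ℂ) := by
  ext i j
  fin_cases i <;> fin_cases j <;> simp [pauliZ, sgn]

theorem onQubit_pauliZ {N : ℕ} (n : Fin N) :
    onQubit n pauliZ = Matrix.diagonal fun x => (sgn (x n) : ℂ) := by
  ext x y
  simp only [onQubit, Matrix.of_apply, pauliZ_eq_diagonal, Matrix.diagonal_apply]
  by_cases h : x = y
  · subst h; simp
  · rw [if_neg h]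
    split_ifs with h1 h2
    · exact absurd (funext fun k => if hk : k = n then hk ▸ h2 else h1 k hk) h
    · rfl
    · rfl

theorem RZZ_eq_diagonal {N : ℕ} (p q : Fin N) (θ : ℝ) :
    RZZ p q θ = Matrix.diagonal fun x =>
      Complex.exp (((-(θ * (sgn (x p) * sgn (x q)) / 2) : ℝ) : ℂ) * Complex.I) := by
  have hs : onQubit p pauliZ * onQubit q pauliZ
      = Matrix.diagonal fun x => ((sgn (x p) * sgn (x q) : ℝ) : ℂ) := by
    rw [onQubit_pauliZ, onQubit_pauliZ, Matrix.diagonal_mul_diagonal]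
    simp
  have hd : ∀ x : Fin N → Fin 2, sgn (x p) * sgn (x q) = 1 ∨ sgn (x p) * sgn (x q) = -1 := by
    intro x
    unfold sgn
    split_ifs <;> norm_num
  rw [RZZ, hs, rot_of_mul_self]
  · ext x y
    simp only [Matrix.sub_apply, Matrix.smul_apply, Matrix.one_apply, Matrix.diagonal_apply]
    by_cases h : x = y
    · subst h
      simp only [if_true, smul_eq_mul]
      rw [Complex.exp_mul_I, ← Complex.ofReal_cos, ← Complex.ofReal_sin]
      rcases hd x with h | h <;> rw [h]
      · rw [show -(θ * 1 / 2) = -(θ / 2) by ring, Real.cos_neg, Real.sin_neg]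
        push_cast
        ring
      · rw [show -(θ * -1 / 2) = θ / 2 by ring]
        push_cast
        ring
    · simp [h]
  · rw [Matrix.diagonal_mul_diagonal, ← Matrix.diagonal_one]
    congr 1
    ext x
    rw [← Complex.ofReal_mul]
    rcases hd x with h | h <;> rw [h] <;> norm_num

/-! ### Weighted phase states -/

/-- The Ising energy with couplings `w`. -/
def energy {N : ℕ} (w : Fin N → Fin N → ℝ) (x : Fin N → Fin 2) : ℝ :=
  1 / 2 * ∑ a, ∑ b, w a b * (sgn (x a) * sgn (x b))

/-- `exp (-(i/2) ∑_{a<b} w_ab Z_a Z_b) |+⟩^{⊗N}`. -/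
def phaseKet {N : ℕ} (w : Fin N → Fin N → ℝ) : Ket N := fun x =>
  (((1 / Real.sqrt 2) ^ N : ℝ) : ℂ) * Complex.exp (((-(energy w x / 2) : ℝ) : ℂ) * Complex.I)

/-- Couplings supported on one pair. -/
def pairWeight {N : ℕ} (p q : Fin N) (θ : ℝ) (a b : Fin N) : ℝ :=
  if (a = p ∧ b = q) ∨ (a = q ∧ b = p) then θ else 0

theorem energy_add {N : ℕ} (w w' : Fin N → Fin N → ℝ) (x : Fin N → Fin 2) :
    energy (w + w') x = energy w x + energy w' x := by
  simp only [energy, Pi.add_apply, add_mul, Finset.sum_add_distrib, mul_add]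

theorem energy_pairWeight {N : ℕ} {p q : Fin N} (h : p ≠ q) (θ : ℝ) (x : Fin N → Fin 2) :
    energy (pairWeight p q θ) x = θ * (sgn (x p) * sgn (x q)) := by
  have : ∀ a b, pairWeight p q θ a b * (sgn (x a) * sgn (x b))
      = (if a = p then if b = q then θ * (sgn (x a) * sgn (x b)) else 0 else 0)
        + (if a = q then if b = p then θ * (sgn (x a) * sgn (x b)) else 0 else 0) := by
    intro a b
    unfold pairWeight
    by_cases h1 : a = p <;> by_cases h2 : b = q <;> by_cases h3 : a = q <;>
      by_cases h4 : b = p <;> simp_all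
  simp only [energy, this, Finset.sum_add_distrib]
  have e : ∀ (c d : Fin N) (f : Fin N → Fin N → ℝ),
      ∑ a, ∑ b, (if a = c then if b = d then f a b else 0 else 0) = f c d := by
    intro c d f
    rw [Finset.sum_eq_single c (by intro a _ ha; simp [ha]) (by simp)]
    simp
  rw [e p q fun a b => θ * (sgn (x a) * sgn (x b)), e q p fun a b => θ * (sgn (x a) * sgn (x b))]
  ring

theorem RZZ_mulVec_phaseKet {N : ℕ} {p q : Fin N} (h : p ≠ q) (θ : ℝ) (w : Fin N → Fin N → ℝ) :
    RZZ p q θ *ᵥ phaseKet w = phaseKet (w + pairWeight p q θ) := by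
  ext x
  rw [RZZ_eq_diagonal, Matrix.mulVec_diagonal, phaseKet, phaseKet, energy_add, energy_pairWeight h,
    mul_left_comm, ← Complex.exp_add]
  congr 2
  push_cast
  ring

theorem hadamards_mulVec_ketZero (N : ℕ) :
    tensor (fun _ : Fin N => hadamard) *ᵥ ketZero N = phaseKet 0 := by
  rw [ketZero_eq_prodKet, tensor_mulVec_prodKet]
  ext x
  have : ∀ b : Fin 2, (hadamard *ᵥ ![1, 0]) b = ((1 / Real.sqrt 2 : ℝ) : ℂ) := by
    intro b
    fin_cases b <;> simp [hadamard, Matrix.mulVec, dotProduct]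
  simp [prodKet, this, phaseKet, energy]

/-! ### Born weights -/

theorem sqNorm_eq_dotProduct {N : ℕ} (ψ : Ket N) : sqNorm ψ = (star ψ ⬝ᵥ ψ).re := by
  simp only [sqNorm, dotProduct, Pi.star_apply, Complex.re_sum, Complex.star_def, Complex.sq_norm,
    Complex.normSq_apply, Complex.mul_re, Complex.conj_re, Complex.conj_im]
  exact Finset.sum_congr rfl fun _ _ => by ring

theorem sqNorm_mulVec {N : ℕ} (U : Op N) (hU : Uᴴ * U = 1) (ψ : Ket N) :
    sqNorm (U *ᵥ ψ) = sqNorm ψ := by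
  rw [sqNorm_eq_dotProduct, sqNorm_eq_dotProduct, Matrix.star_mulVec, ← Matrix.dotProduct_mulVec,
    Matrix.mulVec_mulVec, hU, Matrix.one_mulVec]

theorem bornWeight_mulVec {N : ℕ} (U : Op N) (hU : Uᴴ * U = 1) (P : Pauli) (n : Fin N)
    (hc : onQubit n P.mat * U = U * onQubit n P.mat) (ψ : Ket N) (b : Bool) :
    bornWeight (U *ᵥ ψ) P n b = bornWeight ψ P n b := by
  unfold bornWeight
  rw [← sqNorm_mulVec U hU (_ *ᵥ ψ), Matrix.mulVec_mulVec, Matrix.mulVec_mulVec]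
  congr 2
  simp only [Matrix.smul_mul, Matrix.mul_smul, Matrix.add_mul, Matrix.mul_add, Matrix.one_mul,
    Matrix.mul_one, hc]

theorem bornWeight_smul {N : ℕ} (g : ℂ) (hg : ‖g‖ = 1) (P : Pauli) (n : Fin N)
    (ψ : Ket N) (b : Bool) : bornWeight (g • ψ) P n b = bornWeight ψ P n b := by
  unfold bornWeight
  rw [Matrix.mulVec_smul]
  simp [sqNorm, hg]

theorem onQubit_pauliX_mulVec {N : ℕ} (n : Fin N) (ψ : Ket N) (x : Fin N → Fin 2) :
    (onQubit n pauliX *ᵥ ψ) x = ψ (Function.update x n (1 - x n)) := by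
  simp only [Matrix.mulVec, dotProduct, onQubit, Matrix.of_apply]
  rw [Finset.sum_eq_single (Function.update x n (1 - x n))]
  · rw [if_pos fun k hk => by rw [Function.update_of_ne hk]]
    have : ∀ b : Fin 2, pauliX b (1 - b) = 1 := by
      intro b
      fin_cases b <;> simp [pauliX]
    simp [this]
  · intro y _ hy
    split_ifs with h
    · have h1 : y n ≠ 1 - x n := by
        intro h1
        apply hy
        ext1 k
        by_cases hk : k = n
        · subst hk; simp [h1]
        · simp [hk, h k hk]
      have : ∀ b c : Fin 2, c ≠ 1 - b → pauliX b c = 0 := by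
        intro b c
        fin_cases b <;> fin_cases c <;> simp [pauliX]
      rw [this _ _ h1, zero_mul]
    · simp
  · simp

theorem sgn_one_sub (b : Fin 2) : sgn (1 - b) = -sgn b := by
  fin_cases b <;> simp [sgn]

/-- Flipping the spin at n reverses exactly the terms containing n. By symmetry of w each of them
occurs twice in the double sum, which the prefactor 1/2 compensates. -/
theorem energy_update {N : ℕ} (w : Fin N → Fin N → ℝ) (hs : ∀ a b, w a b = w b a) (n : Fin N)
    (hn : w n n = 0) (x : Fin N → Fin 2) :
    energy w (Function.update x n (1 - x n))
      = energy w x - 2 * (sgn (x n) * ∑ k, w n k * sgn (x k)) := by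
  have hz : ∀ k, sgn (Function.update x n (1 - x n) k)
      = sgn (x k) - if k = n then 2 * sgn (x n) else 0 := by
    intro k
    by_cases hk : k = n
    · subst hk
      simp only [Function.update_self, sgn_one_sub, if_true]
      ring
    · simp [hk]
  have hterm : ∀ a b, w a b * (sgn (Function.update x n (1 - x n) a)
        * sgn (Function.update x n (1 - x n) b))
      = w a b * (sgn (x a) * sgn (x b)) - (if b = n then 2 * sgn (x n) * (w b a * sgn (x a)) else 0)
        - (if a = n then 2 * sgn (x n) * (w a b * sgn (x b)) else 0) := by
    intro a b
    rw [hz, hz]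
    by_cases ha : a = n <;> by_cases hb : b = n
    · subst ha; subst hb; simp [hn]
    · subst ha; simp [hb]; ring
    · subst hb; simp [ha, hs a b]; ring
    · simp [ha, hb]
  simp only [energy, hterm, Finset.sum_sub_distrib, Finset.sum_ite_eq', Finset.mem_univ, if_true]
  have : ∑ a, ∑ b, (if a = n then 2 * sgn (x n) * (w a b * sgn (x b)) else 0)
      = 2 * sgn (x n) * ∑ k, w n k * sgn (x k) := by
    rw [Finset.sum_eq_single n (by intro a _ ha; simp [ha]) (by simp)]
    simp [Finset.mul_sum]
  rw [this, ← Finset.mul_sum]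
  ring

/-- Characteristic function of a sum of independent signs: the sum of exp(i ∑ v_k s_k) over all sign
patterns factorizes, and each factor is 2 cos v_k. -/
theorem sum_cos_sum_sgn {N : ℕ} (v : Fin N → ℝ) :
    ∑ x : Fin N → Fin 2, Real.cos (∑ k, v k * sgn (x k)) = 2 ^ N * ∏ k, Real.cos (v k) := by
  have h : ∏ k, ∑ b : Fin 2, Complex.exp ((v k * sgn b : ℝ) * Complex.I)
      = ((2 ^ N * ∏ k, Real.cos (v k) : ℝ) : ℂ) := by
    have : ∀ k, ∑ b : Fin 2, Complex.exp ((v k * sgn b : ℝ) * Complex.I)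
        = ((2 * Real.cos (v k) : ℝ) : ℂ) := by
      intro k
      rw [Fin.sum_univ_two, Complex.exp_mul_I, Complex.exp_mul_I]
      simp only [sgn]
      push_cast
      simp
      ring
    simp only [this]
    rw [← Complex.ofReal_prod, Finset.prod_mul_distrib]
    simp
  rw [Fintype.prod_sum] at h
  have h2 := congrArg Complex.re h
  rw [Complex.ofReal_re, Complex.re_sum] at h2
  rw [← h2]
  refine Finset.sum_congr rfl fun x _ => ?_
  rw [← Complex.exp_sum, ← Finset.sum_mul, ← Complex.ofReal_sum, Complex.exp_ofReal_mul_I_re]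

/-- X_n flips qubit n, so it multiplies the amplitude at x by a phase of angle ±A with A = ∑ w_nk
s_k. The projected amplitude has relative weight |1 ± e^{iA}|²/4 = (1 ± cos A)/2, and averaging cos
A over x gives the product of cosines. -/
theorem bornWeight_phaseKet {N : ℕ} (w : Fin N → Fin N → ℝ) (hs : ∀ a b, w a b = w b a)
    (n : Fin N) (hn : w n n = 0) (b : Bool) :
    bornWeight (phaseKet w) .X n b
      = (1 + (if b then 1 else -1) * ∏ k, Real.cos (w n k)) / 2 := by
  have hterm : ∀ x, ‖(((1 / 2 : ℂ) • (1 + (if b then (1 : ℂ) else -1) • onQubit n Pauli.X.mat))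
      *ᵥ phaseKet w) x‖ ^ 2
      = (1 / 2) ^ N * (1 / 2 * (1 + (if b then 1 else -1)
        * Real.cos (∑ k, w n k * sgn (x k)))) := by
    intro x
    set A := ∑ k, w n k * sgn (x k) with hA
    have hX : (onQubit n Pauli.X.mat *ᵥ phaseKet w) x
        = phaseKet w x * Complex.exp (((sgn (x n) * A : ℝ) : ℂ) * Complex.I) := by
      rw [Pauli.mat, onQubit_pauliX_mulVec, phaseKet, phaseKet, energy_update w hs n hn, ← hA, mul_assoc,
        ← Complex.exp_add]
      clear_value A
      congr 2
      push_cast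
      ring
    have hcos : Real.cos (sgn (x n) * A) = Real.cos A := by
      unfold sgn
      split_ifs <;> simp
    have hnorm : ‖phaseKet w x‖ ^ 2 = (1 / 2) ^ N := by
      rw [phaseKet, norm_mul, Complex.norm_exp_ofReal_mul_I, mul_one, Complex.norm_real,
        Real.norm_of_nonneg (by positivity), ← pow_mul, mul_comm, pow_mul]
      congr 1
      rw [div_pow, Real.sq_sqrt (by norm_num)]
      norm_num
    rw [Matrix.smul_mulVec, Matrix.add_mulVec, Matrix.one_mulVec, Matrix.smul_mulVec,
      Pi.smul_apply, Pi.add_apply, Pi.smul_apply, hX]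
    rw [show (1 / 2 : ℂ) • (phaseKet w x + (if b then (1 : ℂ) else -1)
        • (phaseKet w x * Complex.exp (((sgn (x n) * A : ℝ) : ℂ) * Complex.I)))
      = phaseKet w x * (1 / 2 * (1 + (if b then (1 : ℂ) else -1)
        * Complex.exp (((sgn (x n) * A : ℝ) : ℂ) * Complex.I))) by
        simp only [smul_eq_mul]; ring]
    rw [norm_mul, mul_pow, hnorm, Complex.sq_norm, Complex.exp_mul_I, ← Complex.ofReal_cos,
      ← Complex.ofReal_sin, hcos, Complex.normSq_apply]
    have hsc := Real.sin_sq_add_cos_sq (sgn (x n) * A)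
    rw [hcos] at hsc
    generalize Real.cos A = C at *
    generalize Real.sin (sgn (x n) * A) = S at *
    congr 1
    cases b <;> simp <;> linear_combination (1 / 4 : ℝ) * hsc
  unfold bornWeight sqNorm
  simp only [hterm]
  rw [← Finset.mul_sum, ← Finset.mul_sum, Finset.sum_add_distrib, ← Finset.mul_sum,
    sum_cos_sum_sgn]
  have h2 : ((1 / 2 : ℝ) ^ N) * 2 ^ N = 1 := by rw [← mul_pow]; norm_num
  simp only [Finset.sum_const, Finset.card_univ, Fintype.card_pi, Fintype.card_fin,
    Finset.prod_const, nsmul_eq_mul, mul_one]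
  push_cast
  linear_combination (1 / 2 * (1 + (if b then 1 else -1) * ∏ k, Real.cos (w n k))) * h2

/-! ### States along a run -/

open Classical in
/-- Hadamard gates on the qubits that `c` has not touched. -/
def freshHadamards {N : ℕ} (c : List (Block N)) : Op N :=
  tensor fun n => if Touched c n then 1 else hadamard

/-- Up to a global phase, the circuit `c` brings `ψ` to the phase state with couplings `w`, followed
by Hadamard gates on the untouched qubits. -/
def Reaches {N : ℕ} (ψ : Ket N) (c : List (Block N)) (w : Fin N → Fin N → ℝ) : Prop :=
  ∃ g : ℂ, ‖g‖ = 1 ∧ blocksOp c *ᵥ ψ = g • (freshHadamards c *ᵥ phaseKet w)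

theorem freshHadamards_unitary {N : ℕ} (c : List (Block N)) :
    (freshHadamards c)ᴴ * freshHadamards c = 1 := by
  rw [freshHadamards, tensor_conjTranspose, tensor_mul, ← tensor_one]
  congr 1
  ext1 n
  split_ifs <;> simp [hadamard_conjTranspose, hadamard_mul_self]

theorem onQubit_commute_freshHadamards {N : ℕ} (c : List (Block N)) (n : Fin N)
    (hn : Touched c n) (A : Matrix (Fin 2) (Fin 2) ℂ) :
    onQubit n A * freshHadamards c = freshHadamards c * onQubit n A := by
  rw [onQubit_eq_tensor, freshHadamards, tensor_mul, tensor_mul]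
  congr 1
  ext1 k
  by_cases h : k = n
  · subst h; simp [hn]
  · simp [h]

/-- The Bloch component `x_n` of the phase state. -/
def xMean {N : ℕ} (w : Fin N → Fin N → ℝ) (n : Fin N) : ℝ := ∏ k, Real.cos (w n k)

/-- The Hadamards still pending sit on untouched qubits only. They commute with X on the touched
qubit n and, being unitary, leave its Born weights unchanged. -/
theorem Reaches.probPlus_eq {N : ℕ} {ψ : Ket N} {c : List (Block N)} {w : Fin N → Fin N → ℝ}
    (h : Reaches ψ c w) (hs : ∀ a b, w a b = w b a) (n : Fin N) (hn : w n n = 0)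
    (ht : Touched c n) :
    probPlus (blocksOp c *ᵥ ψ) .X n = (1 + xMean w n) / 2 := by
  obtain ⟨g, hg, hψ⟩ := h
  have hb : ∀ b, bornWeight (blocksOp c *ᵥ ψ) .X n b
      = (1 + (if b then 1 else -1) * xMean w n) / 2 := by
    intro b
    rw [hψ, bornWeight_smul g hg, bornWeight_mulVec _ (freshHadamards_unitary c) _ _
      (onQubit_commute_freshHadamards c n ht _), bornWeight_phaseKet w hs n hn, xMean]
  rw [probPlus, hb, hb]
  simp only [if_true, Bool.false_eq_true, if_false]
  rw [show (1 + 1 * xMean w n) / 2 + (1 + -1 * xMean w n) / 2 = 1 by ring]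
  ring

theorem blocksOp_append {N : ℕ} (c : List (Block N)) (b : Block N) :
    blocksOp (c ++ [b]) = b.op * blocksOp c := by
  simp [blocksOp]

theorem touched_append {N : ℕ} (c : List (Block N)) (b : Block N) (n : Fin N) :
    Touched (c ++ [b]) n ↔ Touched c n ∨ b.p = n ∨ b.q = n := by
  simp [Touched, or_and_right, exists_or]

open Classical in
theorem candidate_op {N : ℕ} (c : List (Block N)) (p q : Fin N) (h : p ≠ q) (θ : ℝ) :
    (candidate c p q h θ).op = RZZ p q θ *
      (onQubit p (if Touched c p then 1 else (-Complex.I) • hadamard)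
        * onQubit q (if Touched c q then 1 else (-Complex.I) • hadamard)) := by
  have : ∀ n : Fin N, RZ n (if Touched c n then 0 else Real.pi)
      * RY n (if Touched c n then 0 else -(Real.pi / 2))
      = onQubit n (if Touched c n then 1 else (-Complex.I) • hadamard) := by
    intro n
    split_ifs
    · exact RZ_zero_mul_RY_zero n
    · exact RZ_pi_mul_RY_neg n
  rw [← this p, ← this q]
  rfl

theorem Reaches.append_candidate {N : ℕ} {ψ : Ket N} {c : List (Block N)} {w : Fin N → Fin N → ℝ}
    (hr : Reaches ψ c w) (p q : Fin N) (h : p ≠ q) (θ : ℝ) :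
    Reaches ψ (c ++ [candidate c p q h θ]) (w + pairWeight p q θ) := by
  classical
  obtain ⟨g, hg, hψ⟩ := hr
  set c' := c ++ [candidate c p q h θ] with hc'
  have ht : ∀ n, Touched c' n ↔ Touched c n ∨ p = n ∨ q = n := touched_append c _
  -- A freshly touched qubit receives -iH, which meets the pending H. The Hadamards cancel, and the
  -- leftover factors -i form a global phase.
  let u : Fin N → ℂ := fun n => if ¬ Touched c n ∧ Touched c' n then -Complex.I else 1
  have hu : ‖∏ n, u n‖ = 1 := by
    rw [norm_prod]
    refine Finset.prod_eq_one fun n _ => ?_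
    simp only [u]
    split_ifs <;> simp
  have hK : onQubit p (if Touched c p then 1 else (-Complex.I) • hadamard)
        * onQubit q (if Touched c q then 1 else (-Complex.I) • hadamard) * freshHadamards c
      = (∏ n, u n) • freshHadamards c' := by
    rw [freshHadamards, freshHadamards, onQubit_eq_tensor, onQubit_eq_tensor, tensor_mul,
      tensor_mul, ← tensor_smul]
    congr 1
    ext1 n
    simp only [u, ht]
    by_cases hp : n = p
    · subst hp
      by_cases h1 : Touched c n <;> simp [h, h1, hadamard_mul_self]
    · by_cases hq : n = q
      · subst hq
        by_cases h1 : Touched c n <;> simp [hp, h1, hadamard_mul_self]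
      · have hp' : p ≠ n := fun e => hp e.symm
        have hq' : q ≠ n := fun e => hq e.symm
        by_cases h1 : Touched c n <;> simp [hp, hq, hp', hq', h1]
  have hcomm : RZZ p q θ * freshHadamards c' = freshHadamards c' * RZZ p q θ := by
    rw [RZZ_eq_diagonal, freshHadamards]
    refine diagonal_commute_tensor _ _ fun x y hxy => ?_
    rw [hxy p (by simp [ht]), hxy q (by simp [ht])]
  refine ⟨g * ∏ n, u n, by rw [norm_mul, hg, hu, one_mul], ?_⟩
  rw [hc', blocksOp_append, ← hc', ← Matrix.mulVec_mulVec, hψ, Matrix.mulVec_smul,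
    Matrix.mulVec_mulVec, candidate_op, Matrix.mul_assoc, hK, Matrix.mul_smul, hcomm,
    Matrix.smul_mulVec, ← Matrix.mulVec_mulVec, RZZ_mulVec_phaseKet h, smul_smul]

/-! ### Graph states -/

open Classical in
/-- Couplings `π / 4` on the edges of `R`. -/
def graphWeight {N : ℕ} (R : SimpleGraph (Fin N)) (a b : Fin N) : ℝ :=
  if R.Adj a b then Real.pi / 4 else 0

theorem graphWeight_symm {N : ℕ} (R : SimpleGraph (Fin N)) (a b : Fin N) :
    graphWeight R a b = graphWeight R b a := by
  by_cases h : R.Adj a b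
  · simp [graphWeight, h, h.symm]
  · simp only [graphWeight, if_neg h, if_neg fun h' : R.Adj b a => h h'.symm]

theorem prod_RZZ_mulVec_phaseKet {N : ℕ} (θ : ℝ) (l : List (Fin N × Fin N))
    (hl : ∀ e ∈ l, e.1 ≠ e.2) (w : Fin N → Fin N → ℝ) :
    (l.map fun e => RZZ e.1 e.2 θ).prod *ᵥ phaseKet w
      = phaseKet (w + (l.map fun e => pairWeight e.1 e.2 θ).sum) := by
  induction l with
  | nil => simp
  | cons e l ih =>
    rw [List.map_cons, List.prod_cons, ← Matrix.mulVec_mulVec,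
      ih fun e he => hl e (List.mem_cons_of_mem _ he), RZZ_mulVec_phaseKet (hl e List.mem_cons_self),
      List.map_cons, List.sum_cons, add_assoc, add_comm (List.sum _)]

theorem mem_pairs {N : ℕ} (e : Fin N × Fin N) : e ∈ pairs N ↔ e.1 < e.2 := by
  simp [pairs, List.product, List.mem_filter]

theorem nodup_pairs (N : ℕ) : (pairs N).Nodup :=
  ((List.nodup_finRange N).product (List.nodup_finRange N)).filter _

theorem length_pairs_le (N : ℕ) : (pairs N).length ≤ N ^ 2 := by
  refine (List.length_filter_le _ _).trans ?_
  change (List.finRange N ×ˢ List.finRange N).length ≤ _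
  rw [List.length_product, List.length_finRange, sq]

theorem sum_pairWeight_eq_graphWeight {N : ℕ} (G : SimpleGraph (Fin N)) [DecidableRel G.Adj] :
    (((pairs N).filter fun e => G.Adj e.1 e.2).map fun e => pairWeight e.1 e.2 (Real.pi / 4)).sum
      = graphWeight G := by
  classical
  rw [← List.sum_toFinset _ ((nodup_pairs N).filter _)]
  ext a b
  rw [Finset.sum_apply, Finset.sum_apply]
  have key : ∀ a b : Fin N, a < b → ∑ e ∈ ((pairs N).filter fun e => G.Adj e.1 e.2).toFinset,
      pairWeight e.1 e.2 (Real.pi / 4) a b = graphWeight G a b := by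
    intro a b hab
    have hne : ∀ e ∈ ((pairs N).filter fun e => G.Adj e.1 e.2).toFinset, e ≠ (a, b) →
        pairWeight e.1 e.2 (Real.pi / 4) a b = 0 := by
      rintro ⟨p, q⟩ he hne
      simp only [List.mem_toFinset, List.mem_filter, mem_pairs] at he
      unfold pairWeight
      rw [if_neg]
      rintro (⟨rfl, rfl⟩ | ⟨rfl, rfl⟩)
      · exact hne rfl
      · exact absurd he.1 hab.not_gt
    by_cases hG : G.Adj a b
    · rw [Finset.sum_eq_single (a, b) hne]
      · simp [pairWeight, graphWeight, hG]
      · intro h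
        simp [mem_pairs, hab, hG] at h
    · rw [Finset.sum_eq_zero fun e he => hne e he ?_]
      · simp [graphWeight, hG]
      · rintro rfl
        simp [hG] at he
  rcases lt_trichotomy a b with h | h | h
  · exact key a b h
  · subst h
    rw [Finset.sum_eq_zero]
    · simp [graphWeight]
    · rintro ⟨p, q⟩ he
      simp only [List.mem_toFinset, List.mem_filter, mem_pairs] at he
      unfold pairWeight
      rw [if_neg]
      rintro (⟨rfl, rfl⟩ | ⟨rfl, rfl⟩) <;> exact lt_irrefl _ he.1
  · rw [graphWeight_symm, ← key b a h]
    refine Finset.sum_congr rfl fun e _ => ?_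
    unfold pairWeight
    simp only [or_comm, and_comm]

theorem reaches_nil {N : ℕ} (G : SimpleGraph (Fin N)) [DecidableRel G.Adj] :
    Reaches (iqpState G) [] (graphWeight G) := by
  refine ⟨1, norm_one, ?_⟩
  rw [one_smul, iqpState, onAll_onQubit, ← Matrix.mulVec_mulVec, ← Matrix.mulVec_mulVec,
    hadamards_mulVec_ketZero, prod_RZZ_mulVec_phaseKet, sum_pairWeight_eq_graphWeight, zero_add]
  · simp [blocksOp, freshHadamards, Touched]
  · intro e he
    exact ((mem_pairs e).1 (List.mem_of_mem_filter he)).ne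

theorem pairWeight_symm {N : ℕ} (p q : Fin N) (θ : ℝ) (a b : Fin N) :
    pairWeight p q θ a b = pairWeight p q θ b a := by
  simp only [pairWeight, or_comm, and_comm]

theorem pairWeight_comm {N : ℕ} (p q : Fin N) (θ : ℝ) : pairWeight p q θ = pairWeight q p θ := by
  ext a b
  simp only [pairWeight, or_comm]

theorem graphWeight_deleteEdge {N : ℕ} (R : SimpleGraph (Fin N)) {p q : Fin N} (h : R.Adj p q) :
    graphWeight R + pairWeight p q (-(Real.pi / 4)) = graphWeight (R.deleteEdges {s(p, q)}) := by
  ext a b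
  have hd : (R.deleteEdges {s(p, q)}).Adj a b
      ↔ R.Adj a b ∧ ¬((a = p ∧ b = q) ∨ (a = q ∧ b = p)) := by
    rw [SimpleGraph.deleteEdges_adj, Set.mem_singleton_iff, Sym2.eq_iff]
  rw [Pi.add_apply, Pi.add_apply]
  unfold graphWeight pairWeight
  by_cases hab : (a = p ∧ b = q) ∨ (a = q ∧ b = p)
  · have hR : R.Adj a b := by
      rcases hab with ⟨rfl, rfl⟩ | ⟨rfl, rfl⟩
      exacts [h, h.symm]
    rw [if_pos hR, if_pos hab, if_neg fun h' => (hd.1 h').2 hab, add_neg_cancel]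
  · rw [if_neg hab, add_zero]
    by_cases hR : R.Adj a b
    · rw [if_pos hR, if_pos (hd.2 ⟨hR, hab⟩)]
    · rw [if_neg hR, if_neg fun h' => hR (hd.1 h').1]

/-- The factor of `x_p` that does not depend on the coupling with `q`. -/
def coherence {N : ℕ} (R : SimpleGraph (Fin N)) (p q : Fin N) : ℝ :=
  ∏ k ∈ Finset.univ.erase q, Real.cos (graphWeight R p k)

/-- In the product of cosines for qubit p only the factor of q sees the angle θ. -/
theorem xMean_add_pairWeight {N : ℕ} (R : SimpleGraph (Fin N)) {p q : Fin N} (h : p ≠ q) (θ : ℝ) :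
    xMean (graphWeight R + pairWeight p q θ) p
      = Real.cos (graphWeight R p q + θ) * coherence R p q := by
  rw [xMean, ← Finset.mul_prod_erase _ _ (Finset.mem_univ q), coherence]
  congr 1
  · simp [pairWeight]
  · refine Finset.prod_congr rfl fun k hk => ?_
    have hk' := Finset.ne_of_mem_erase hk
    simp [pairWeight, hk', h]

theorem cos_graphWeight {N : ℕ} (R : SimpleGraph (Fin N)) [DecidableRel R.Adj] (a b : Fin N) :
    Real.cos (graphWeight R a b) = if R.Adj a b then Real.sqrt 2 / 2 else 1 := by
  unfold graphWeight
  by_cases h : R.Adj a b <;> simp [h]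

theorem sqrt_two_div_two_le_one : Real.sqrt 2 / 2 ≤ 1 := by
  have := Real.sqrt_two_lt_three_halves
  linarith

/-- Each neighbour of p in R contributes √2/2 and every other qubit contributes 1. As R ≤ G, there
are at most D neighbours. -/
theorem pow_le_coherence {N D : ℕ} {R G : SimpleGraph (Fin N)} [DecidableRel G.Adj] (hR : R ≤ G)
    (hD : ∀ n, G.degree n ≤ D) (p q : Fin N) : (Real.sqrt 2 / 2) ^ D ≤ coherence R p q := by
  classical
  have h0 : (0 : ℝ) ≤ Real.sqrt 2 / 2 := by positivity
  calc (Real.sqrt 2 / 2) ^ D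
      ≤ (Real.sqrt 2 / 2) ^ ((Finset.univ.erase q).filter (R.Adj p)).card := by
        refine pow_le_pow_of_le_one h0 sqrt_two_div_two_le_one (le_trans ?_ (hD p))
        rw [← G.card_neighborFinset_eq_degree]
        refine Finset.card_le_card fun k hk => ?_
        rw [SimpleGraph.mem_neighborFinset]
        exact hR (Finset.mem_filter.1 hk).2
    _ = coherence R p q := by
        simp only [coherence, cos_graphWeight]
        rw [Finset.prod_ite]
        simp [div_pow]

/-! ### Step II -/

theorem blocksOp_unitary {N : ℕ} (c : List (Block N)) : (blocksOp c)ᴴ * blocksOp c = 1 := by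
  have hr : ∀ (σ : Op N) (_ : σ * σ = 1) (_ : σᴴ = σ) (θ : ℝ), (rot σ θ)ᴴ * rot σ θ = 1 := by
    intro σ h1 h2 θ
    rw [rot_of_mul_self σ h1]
    have hsc : ((Real.cos (θ / 2) : ℝ) : ℂ) ^ 2 + ((Real.sin (θ / 2) : ℝ) : ℂ) ^ 2 = 1 := by
      rw [← Complex.ofReal_pow, ← Complex.ofReal_pow, ← Complex.ofReal_add,
        Real.cos_sq_add_sin_sq, Complex.ofReal_one]
    simp only [Matrix.conjTranspose_sub, Matrix.conjTranspose_smul, Matrix.conjTranspose_one, h2,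
      Matrix.sub_mul, Matrix.mul_sub, Matrix.smul_mul, Matrix.mul_smul, Matrix.one_mul,
      Matrix.mul_one, h1, star_mul', Complex.star_def, Complex.conj_I, Complex.conj_ofReal]
    generalize ((Real.cos (θ / 2) : ℝ) : ℂ) = C at *
    generalize ((Real.sin (θ / 2) : ℝ) : ℂ) = S at *
    match_scalars
    · linear_combination hsc - S ^ 2 * Complex.I_sq
    · ring
  have hYc : pauliYᴴ = pauliY := by
    ext i j
    fin_cases i <;> fin_cases j <;> simp [pauliY]
  have hZc : pauliZᴴ = pauliZ := by
    ext i j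
    fin_cases i <;> fin_cases j <;> simp [pauliZ]
  have hY : ∀ (n : Fin N) θ, (RY n θ)ᴴ * RY n θ = 1 := fun n θ =>
    hr _ (by rw [onQubit_mul, pauliY_mul_self, onQubit_one])
      (by rw [onQubit_conjTranspose, hYc]) θ
  have hZ : ∀ (n : Fin N) θ, (RZ n θ)ᴴ * RZ n θ = 1 := fun n θ =>
    hr _ (by rw [onQubit_mul, pauliZ_mul_self, onQubit_one])
      (by rw [onQubit_conjTranspose, hZc]) θ
  have hZZ : ∀ (p q : Fin N) θ, (RZZ p q θ)ᴴ * RZZ p q θ = 1 := by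
    intro p q θ
    have hcomm : onQubit p pauliZ * onQubit q pauliZ = onQubit q pauliZ * onQubit p pauliZ := by
      simp only [onQubit_pauliZ, Matrix.diagonal_mul_diagonal, mul_comm]
    refine hr _ ?_ ?_ θ
    · rw [Matrix.mul_assoc, ← Matrix.mul_assoc (onQubit q _), ← hcomm, Matrix.mul_assoc,
        onQubit_mul, pauliZ_mul_self, onQubit_one, Matrix.mul_one, onQubit_mul, pauliZ_mul_self,
        onQubit_one]
    · rw [Matrix.conjTranspose_mul, onQubit_conjTranspose, onQubit_conjTranspose, hZc, hcomm]
  have hmul : ∀ A B : Op N, Aᴴ * A = 1 → Bᴴ * B = 1 → (A * B)ᴴ * (A * B) = 1 := by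
    intro A B hA hB
    rw [Matrix.conjTranspose_mul, Matrix.mul_assoc, ← Matrix.mul_assoc Aᴴ, hA, Matrix.one_mul, hB]
  induction c using List.reverseRecOn with
  | nil => simp [blocksOp]
  | append_singleton c b ih =>
    rw [blocksOp_append]
    exact hmul _ _ (hmul _ _ (hZZ _ _ _) (hmul _ _ (hmul _ _ (hZ _ _) (hY _ _))
      (hmul _ _ (hZ _ _) (hY _ _)))) ih

/-- The output of AQER when Step I has found the blocks `c`. -/
def loaderOf {N : ℕ} (c : List (Block N)) : Loader N :=
  ⟨c, fun n => betaAngle (residual c n), fun n => gammaAngle (residual c n)⟩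

/-- Without couplings the state is |+⟩ on touched qubits and H|+⟩ = |0⟩ on the others, which is what
the angles of Step II prepare. Unitarity of V then undoes the blocks. -/
theorem Reaches.loadsExactly {N : ℕ} {ψ : Ket N} {c : List (Block N)} (h : Reaches ψ c 0) :
    (loaderOf c).LoadsExactly ψ := by
  classical
  obtain ⟨g, hg, hψ⟩ := h
  have hrot : ∀ n, RZ n (betaAngle (residual c n)) * RY n (gammaAngle (residual c n))
      = onQubit n (if Touched c n then ((1 / Real.sqrt 2 : ℝ) : ℂ) • !![1, -1; 1, 1] else 1) := by
    intro n
    by_cases ht : Touched c n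
    · have hβ : betaAngle (residual c n) = 0 := by
        rw [betaAngle, Complex.arg_eq_zero_iff]
        simp [residual, ht, blochX, pauliX]
      have hγ : gammaAngle (residual c n) = Real.pi / 2 := by
        simp [gammaAngle, residual, ht, blochX, pauliX]
      have h2 : Real.sqrt 2 / 2 = 1 / Real.sqrt 2 := by
        rw [div_eq_div_iff (by norm_num) (by positivity), Real.mul_self_sqrt (by norm_num)]
        norm_num
      rw [hβ, hγ, if_pos ht, RZ, RY, rot_onQubit n _ pauliZ_mul_self,
        rot_onQubit n _ pauliY_mul_self, onQubit_mul, show Real.pi / 2 / 2 = Real.pi / 4 by ring,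
        Real.cos_pi_div_four, Real.sin_pi_div_four, h2]
      congr 1
      ext i j
      fin_cases i <;> fin_cases j <;>
        simp [pauliY, Matrix.mul_apply] <;> ring_nf <;> simp
    -- Here ρ₁₀ = 0, and the convention arg 0 = 0 supplies the angle.
    · have hβ : betaAngle (residual c n) = 0 := by
        simp [betaAngle, residual, ht]
      have hγ : gammaAngle (residual c n) = 0 := by
        simp [gammaAngle, residual, ht]
      rw [hβ, hγ, if_neg ht, RZ_zero_mul_RY_zero]
  have hW : onAll (fun n => RZ n ((loaderOf c).β n) * RY n ((loaderOf c).γ n)) *ᵥ ketZero N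
      = freshHadamards c *ᵥ phaseKet 0 := by
    change onAll (fun n => RZ n (betaAngle (residual c n)) * RY n (gammaAngle (residual c n)))
      *ᵥ ketZero N = _
    simp only [hrot]
    rw [onAll_onQubit, ← hadamards_mulVec_ketZero, Matrix.mulVec_mulVec, freshHadamards,
      tensor_mul, ketZero_eq_prodKet, tensor_mulVec_prodKet, tensor_mulVec_prodKet]
    congr 1
    ext n i
    by_cases ht : Touched c n
    · simp only [ht, if_true, Matrix.one_mul]
      fin_cases i <;> simp [hadamard, Matrix.mulVec, dotProduct]
    · simp [ht, hadamard_mul_self]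
  have hg0 : g ≠ 0 := by
    rintro rfl
    simp at hg
  refine ⟨g.arg, ?_⟩
  have hginv : Complex.exp (-(Complex.I * (g.arg : ℂ))) = g⁻¹ := by
    have := Complex.norm_mul_exp_arg_mul_I g
    rw [hg, Complex.ofReal_one, one_mul] at this
    rw [Complex.exp_neg, mul_comm Complex.I, this]
  have hW' : freshHadamards c *ᵥ phaseKet 0 = g⁻¹ • (blocksOp c *ᵥ ψ) := by
    rw [hψ, smul_smul, inv_mul_cancel₀ hg0, one_smul]
  rw [hginv, Loader.op, ← Matrix.mulVec_mulVec, hW, hW', Matrix.mulVec_smul, Matrix.mulVec_mulVec]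
  change g⁻¹ • (((blocksOp c)ᴴ * blocksOp c) *ᵥ ψ) = _
  rw [blocksOp_unitary, Matrix.one_mulVec]

namespace CopyAlg

/-! ### Expectations and failure probabilities -/

/-- The expectation of `f` over the returned value. -/
def expect {N : ℕ} {α : Type} (ψ : Ket N) (f : α → ℝ) : CopyAlg N α → ℝ
  | done a => f a
  | measure c P n next =>
      probPlus (blocksOp c *ᵥ ψ) P n * (next true).expect ψ f
        + (1 - probPlus (blocksOp c *ᵥ ψ) P n) * (next false).expect ψ f

theorem expect_bind {N : ℕ} {α β : Type} (ψ : Ket N) (f : β → ℝ) (a : CopyAlg N α)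
    (g : α → CopyAlg N β) : (a.bind g).expect ψ f = a.expect ψ fun x => (g x).expect ψ f := by
  induction a with
  | done a => rfl
  | measure c P n next ih => simp only [CopyAlg.bind, expect, ih]

theorem expect_mono {N : ℕ} {α : Type} (ψ : Ket N) {f g : α → ℝ} (h : ∀ x, f x ≤ g x)
    (a : CopyAlg N α) : a.expect ψ f ≤ a.expect ψ g := by
  induction a with
  | done a => exact h a
  | measure c P n next ih =>
    exact add_le_add (mul_le_mul_of_nonneg_left (ih _) (probPlus_nonneg ..))
      (mul_le_mul_of_nonneg_left (ih _) (sub_nonneg.2 (probPlus_le_one ..)))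

theorem expect_add {N : ℕ} {α : Type} (ψ : Ket N) (f g : α → ℝ) (a : CopyAlg N α) :
    (a.expect ψ fun x => f x + g x) = a.expect ψ f + a.expect ψ g := by
  induction a with
  | done a => rfl
  | measure c P n next ih =>
    simp only [expect, ih]
    ring

theorem expect_const {N : ℕ} {α : Type} (ψ : Ket N) (r : ℝ) (a : CopyAlg N α) :
    (a.expect ψ fun _ => r) = r := by
  induction a with
  | done a => rfl
  | measure c P n next ih =>
    simp only [expect, ih]
    ring

theorem expect_mul_const {N : ℕ} {α : Type} (ψ : Ket N) (f : α → ℝ) (r : ℝ) (a : CopyAlg N α) :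
    (a.expect ψ fun x => f x * r) = a.expect ψ f * r := by
  induction a with
  | done a => rfl
  | measure c P n next ih =>
    simp only [expect, ih]
    ring

open Classical in
/-- The probability that the returned value does not satisfy `p`. -/
def failure {N : ℕ} {α : Type} (ψ : Ket N) (p : α → Prop) (a : CopyAlg N α) : ℝ :=
  a.expect ψ fun x => if p x then 0 else 1

theorem failure_le_one {N : ℕ} {α : Type} (ψ : Ket N) (p : α → Prop) (a : CopyAlg N α) :
    a.failure ψ p ≤ 1 := by
  rw [← expect_const ψ 1 a]
  refine expect_mono ψ (fun x => ?_) a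
  split_ifs <;> norm_num

theorem failure_done {N : ℕ} {α : Type} (ψ : Ket N) {p : α → Prop} {x : α} (h : p x) :
    (done x : CopyAlg N α).failure ψ p = 0 := by
  simp [failure, expect, h]

theorem failure_mono {N : ℕ} {α : Type} (ψ : Ket N) {p q : α → Prop} (h : ∀ x, p x → q x)
    (a : CopyAlg N α) : a.failure ψ q ≤ a.failure ψ p := by
  refine expect_mono ψ (fun x => ?_) a
  by_cases hp : p x
  · simp [hp, h x hp]
  · simp only [hp, if_false]
    split_ifs <;> norm_num

/-- Union bound for sequential composition: either the first stage misses p, or the second fails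
from a good intermediate value. -/
theorem failure_bind_le {N : ℕ} {α β : Type} (ψ : Ket N) (p : α → Prop) (q : β → Prop)
    (a : CopyAlg N α) (g : α → CopyAlg N β) {ε : ℝ} (hε : 0 ≤ ε)
    (h : ∀ x, p x → (g x).failure ψ q ≤ ε) : (a.bind g).failure ψ q ≤ a.failure ψ p + ε := by
  classical
  unfold failure
  rw [expect_bind, ← expect_const ψ ε a, ← expect_add]
  refine expect_mono ψ (fun x => ?_) a
  by_cases hx : p x
  · simpa [hx, failure] using h x hx
  · have := failure_le_one ψ q (g x)
    unfold failure at this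
    simp only [hx, if_false]
    linarith

/-- Bridge from the recursively defined real-valued failure probability to the measure of the law
`run`. The number of copies plays no role in the event. -/
theorem toOuterMeasure_run {N : ℕ} {α : Type} (ψ : Ket N) (p : α → Prop) (a : CopyAlg N α) :
    (a.run ψ).toOuterMeasure {r | p r.1} = ENNReal.ofReal (1 - a.failure ψ p) := by
  classical
  induction a with
  | done a =>
    rw [run, PMF.toOuterMeasure_pure_apply]
    by_cases h : p a <;> simp [failure, expect, h]
  | measure c P n next ih =>
    have h0 := probPlus_nonneg (blocksOp c *ᵥ ψ) P n
    have h1 := probPlus_le_one (blocksOp c *ᵥ ψ) P n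
    have hf := fun b => failure_le_one ψ p (next b)
    rw [run, PMF.toOuterMeasure_bind_apply, tsum_bool]
    simp only [PMF.toOuterMeasure_map_apply, Set.preimage_ofPred_eq, ih, shot, PMF.ofFintype_apply,
      if_true, Bool.false_eq_true, if_false]
    rw [← ENNReal.ofReal_mul (by linarith), ← ENNReal.ofReal_mul h0,
      ← ENNReal.ofReal_add (mul_nonneg (by linarith) (by linarith [hf false]))
        (mul_nonneg h0 (by linarith [hf true]))]
    congr 1
    simp only [failure, expect]
    ring

/-! ### Properties of all runs -/

/-- `P` holds for the returned value and the number of copies used in every run, whatever the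
outcomes. -/
def AllRuns {N : ℕ} {α : Type} : (α → ℕ → Prop) → CopyAlg N α → Prop
  | P, done a => P a 0
  | P, measure _ _ _ next => ∀ b, AllRuns (fun a n => P a (n + 1)) (next b)

theorem AllRuns.mono {N : ℕ} {α : Type} {P Q : α → ℕ → Prop} (h : ∀ a n, P a n → Q a n)
    {a : CopyAlg N α} (ha : AllRuns P a) : AllRuns Q a := by
  induction a generalizing P Q with
  | done a => exact h _ _ ha
  | measure c O n next ih => exact fun b => ih b (fun a n => h a (n + 1)) (ha b)

theorem AllRuns.bind {N : ℕ} {α β : Type} {P : α → ℕ → Prop} {Q : β → ℕ → Prop}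
    {a : CopyAlg N α} (ha : AllRuns P a) {f : α → CopyAlg N β}
    (hf : ∀ x n, P x n → AllRuns (fun y m => Q y (n + m)) (f x)) : AllRuns Q (a.bind f) := by
  induction a generalizing P Q with
  | done a =>
    have := hf a 0 ha
    simp only [zero_add] at this
    exact this
  | measure c O n next ih =>
    refine fun b => ih b (ha b) fun x n hx => ?_
    refine (hf x (n + 1) hx).mono fun y m h => ?_
    rwa [add_right_comm]

theorem AllRuns.of_mem_support {N : ℕ} {α : Type} {P : α → ℕ → Prop} {a : CopyAlg N α}
    (ha : AllRuns P a) (ψ : Ket N) {r : α × ℕ} (hr : r ∈ (a.run ψ).support) : P r.1 r.2 := by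
  induction a generalizing P r with
  | done a =>
    rw [run, PMF.mem_support_pure_iff] at hr
    subst hr
    exact ha
  | measure c O n next ih =>
    rw [run, PMF.mem_support_bind_iff] at hr
    obtain ⟨b, _, hb⟩ := hr
    rw [PMF.mem_support_map_iff] at hb
    obtain ⟨s, hs, rfl⟩ := hb
    exact ih b (ha b) hs

end CopyAlg

open CopyAlg

/-! ### Costs -/

theorem allRuns_outcomeSum {N : ℕ} (c : List (Block N)) (n : Fin N) (M : ℕ) :
    AllRuns (fun _ k => k = M) (outcomeSum c n M) := by
  induction M with
  | zero => rfl
  | succ M ih =>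
    refine fun b => ih.bind fun s k hk => ?_
    subst hk
    rfl

theorem allRuns_entropyEst {N : ℕ} (M : ℕ) (c : List (Block N)) (n : Fin N) :
    AllRuns (fun _ k => k = M) (entropyEst M c n) :=
  (allRuns_outcomeSum c n M).bind fun _ _ hk => hk

theorem allRuns_changeEst {N : ℕ} (M : ℕ) (c : List (Block N)) (p q : Fin N) (h : p ≠ q) :
    AllRuns (fun _ k => k = 4 * M) (changeEst M c p q h) := by
  refine (allRuns_entropyEst M _ p).bind fun _ _ h1 => ?_
  refine (allRuns_entropyEst M _ q).bind fun _ _ h2 => ?_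
  refine (allRuns_entropyEst M _ p).bind fun _ _ h3 => ?_
  refine (allRuns_entropyEst M _ q).bind fun _ _ h4 => ?_
  change _ = _
  omega

theorem allRuns_scan {N : ℕ} (M : ℕ) (c : List (Block N)) (l : List (Fin N × Fin N)) :
    AllRuns (fun _ k => k ≤ 4 * M * l.length) (scan M c l) := by
  induction l with
  | nil => exact Nat.zero_le _
  | cons e l ih =>
    rw [scan]
    split_ifs with h
    · refine (allRuns_changeEst M c e.1 e.2 h).bind fun v n hn => ?_
      refine ih.bind fun r m hm => ?_
      change n + (m + 0) ≤ _
      rw [List.length_cons, mul_add_one]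
      omega
    · refine ih.mono fun r m hm => hm.trans ?_
      rw [List.length_cons]
      gcongr
      omega

/-- A scan costs at most K = 4M·(number of pairs). The last clause bounds the cost by K times one
more than the number of appended blocks, the extra scan being the one that finds no negative change.
It is stated additively to avoid subtraction in ℕ. -/
theorem allRuns_stepI {N : ℕ} (M k : ℕ) (c : List (Block N)) :
    AllRuns (fun c' n => c'.length ≤ c.length + k ∧ n ≤ 4 * M * (pairs N).length * k ∧
      n + 4 * M * (pairs N).length * c.length ≤ 4 * M * (pairs N).length * (c'.length + 1))
      (stepI M k c) := by
  induction k generalizing c with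
  | zero =>
    refine ⟨le_rfl, Nat.zero_le _, ?_⟩
    rw [mul_add_one]
    omega
  | succ k ih =>
    rw [stepI]
    refine (allRuns_scan M c (pairs N)).bind fun r n hn => ?_
    generalize 4 * M * (pairs N).length = K at *
    have hdone : AllRuns (fun c' m => c'.length ≤ c.length + (k + 1) ∧ n + m ≤ K * (k + 1) ∧
        n + m + K * c.length ≤ K * (c'.length + 1)) (.done c : CopyAlg N _) := by
      refine ⟨by omega, ?_, ?_⟩ <;> rw [mul_add_one] <;> nlinarith
    cases r.argmin Prod.snd with
    | none => exact hdone
    | some bv =>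
      obtain ⟨b, v⟩ := bv
      dsimp only
      split_ifs with hv
      · refine (ih (c ++ [b])).mono fun c' m hm => ?_
        simp only [List.length_append, List.length_singleton, mul_add_one] at hm ⊢
        omega
      · exact hdone

/-! ### Estimates -/

/-- Hoeffding's lemma for a ±1 variable of mean x: the range has length 2, so the sub-Gaussian
parameter is (2/2)² = 1. -/
theorem two_point_exp_le {x : ℝ} (h0 : -1 ≤ x) (h1 : x ≤ 1) (t : ℝ) :
    (1 + x) / 2 * Real.exp (t * (1 - x)) + (1 - (1 + x) / 2) * Real.exp (t * (-1 - x))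
      ≤ Real.exp (t ^ 2 / 2) := by
  let μ : PMF Bool := PMF.ofFintype
    (fun b => ENNReal.ofReal (if b then (1 + x) / 2 else 1 - (1 + x) / 2)) (by
      rw [Fintype.sum_bool]
      simp only [if_true, Bool.false_eq_true, if_false]
      rw [← ENNReal.ofReal_add (by linarith) (by linarith)]
      simp)
  let X : Bool → ℝ := fun b => if b then 1 else -1
  have hint : ∀ f : Bool → ℝ, ∫ b, f b ∂μ.toMeasure
      = (1 + x) / 2 * f true + (1 - (1 + x) / 2) * f false := by
    intro f
    rw [PMF.integral_eq_sum, Fintype.sum_bool]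
    simp only [μ, PMF.ofFintype_apply, if_true, Bool.false_eq_true, if_false, smul_eq_mul]
    rw [ENNReal.toReal_ofReal (by linarith), ENNReal.toReal_ofReal (by linarith)]
  have key := (ProbabilityTheory.hasSubgaussianMGF_of_mem_Icc (μ := μ.toMeasure) (X := X)
    (a := -1) (b := 1) (measurable_of_finite X).aemeasurable
    (Filter.Eventually.of_forall fun b => by cases b <;> simp [X])).mgf_le t
  rw [ProbabilityTheory.mgf, hint, hint] at key
  have hx : (1 + x) / 2 * X true + (1 - (1 + x) / 2) * X false = x := by
    simp only [X, if_true, Bool.false_eq_true, if_false]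
    ring
  rw [hx] at key
  have hc : (((‖(1 : ℝ) - -1‖₊ / 2) ^ 2 : NNReal) : ℝ) = 1 := by
    push_cast
    norm_num
  rw [hc] at key
  simpa [X] using key

theorem expect_exp_outcomeSum_le {N : ℕ} {ψ : Ket N} {c : List (Block N)} {n : Fin N} {x : ℝ}
    (h : probPlus (blocksOp c *ᵥ ψ) .X n = (1 + x) / 2) (t : ℝ) (M : ℕ) :
    ((outcomeSum c n M).expect ψ fun s => Real.exp (t * (s - M * x)))
      ≤ Real.exp (M * (t ^ 2 / 2)) := by
  have h0 := probPlus_nonneg (blocksOp c *ᵥ ψ) .X n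
  have h1 := probPlus_le_one (blocksOp c *ᵥ ψ) .X n
  rw [h] at h0 h1
  induction M with
  | zero => simp [outcomeSum, expect]
  | succ M ih =>
    have hs : ∀ d s : ℝ, Real.exp (t * (s + d - ((M + 1 : ℕ) : ℝ) * x))
        = Real.exp (t * (s - M * x)) * Real.exp (t * (d - x)) := by
      intro d s
      rw [← Real.exp_add]
      congr 1
      push_cast
      ring
    simp only [outcomeSum, expect, expect_bind, h, hs, expect_mul_const, if_true,
      Bool.false_eq_true, if_false]
    rw [show ((M + 1 : ℕ) : ℝ) * (t ^ 2 / 2) = M * (t ^ 2 / 2) + t ^ 2 / 2 by push_cast; ring,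
      Real.exp_add]
    have key := two_point_exp_le (x := x) (by linarith) (by linarith) t
    calc _ = ((outcomeSum c n M).expect ψ fun s => Real.exp (t * (s - M * x)))
          * ((1 + x) / 2 * Real.exp (t * (1 - x))
            + (1 - (1 + x) / 2) * Real.exp (t * (-1 - x))) := by ring
      _ ≤ _ := by
        refine mul_le_mul ih key ?_ (Real.exp_pos _).le
        exact add_nonneg (mul_nonneg (by linarith) (Real.exp_pos _).le)
          (mul_nonneg (by linarith) (Real.exp_pos _).le)

/-- Hoeffding's bound for the failure probability of one estimate from `M` copies. -/
def hoeffdingBound (M : ℕ) (ε : ℝ) : ℝ := 2 * Real.exp (-(M * (ε ^ 2 / 2)))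

theorem hoeffdingBound_nonneg (M : ℕ) (ε : ℝ) : 0 ≤ hoeffdingBound M ε := by
  unfold hoeffdingBound
  positivity

theorem failure_outcomeSum_le {N : ℕ} {ψ : Ket N} {c : List (Block N)} {n : Fin N} {x : ℝ}
    (h : probPlus (blocksOp c *ᵥ ψ) .X n = (1 + x) / 2) {M : ℕ} (hM : 0 < M) {ε : ℝ}
    (hε : 0 < ε) :
    (outcomeSum c n M).failure ψ (fun s => |s / M - x| < ε) ≤ hoeffdingBound M ε := by
  classical
  have hM' : (0 : ℝ) < M := by exact_mod_cast hM
  have hp := expect_exp_outcomeSum_le h ε M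
  have hn := expect_exp_outcomeSum_le h (-ε) M
  -- Chernoff's bound for both tails at t = ±ε, the value that minimizes M t²/2 - M|t|ε.
  calc _ ≤ (outcomeSum c n M).expect ψ fun s =>
          Real.exp (ε * (s - M * x)) * Real.exp (-(M * ε ^ 2))
          + Real.exp (-ε * (s - M * x)) * Real.exp (-(M * ε ^ 2)) := by
        refine expect_mono ψ (fun s => ?_) _
        split_ifs with hs
        · positivity
        · rw [not_lt, le_abs] at hs
          rw [← Real.exp_add, ← Real.exp_add]
          have hd : s / M - x = (s - M * x) / M := by field_simp
          rw [hd, ← neg_div, le_div_iff₀ hM', le_div_iff₀ hM'] at hs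
          rcases hs with hs | hs
          · refine le_add_of_le_of_nonneg (Real.one_le_exp ?_) (Real.exp_pos _).le
            nlinarith
          · refine le_add_of_nonneg_of_le (Real.exp_pos _).le (Real.one_le_exp ?_)
            nlinarith
    _ ≤ Real.exp (M * (ε ^ 2 / 2)) * Real.exp (-(M * ε ^ 2))
        + Real.exp (M * ((-ε) ^ 2 / 2)) * Real.exp (-(M * ε ^ 2)) := by
        rw [expect_add, expect_mul_const, expect_mul_const]
        gcongr
    _ = hoeffdingBound M ε := by
        rw [← Real.exp_add, ← Real.exp_add, hoeffdingBound, neg_sq, ← two_mul]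
        congr 2
        ring

theorem renyi_blochX (y : ℝ) : renyi (blochX y) = -Real.logb 2 ((1 + y ^ 2) / 2) := by
  have : (blochX y * blochX y).trace = (((1 + y ^ 2) / 2 : ℝ) : ℂ) := by
    simp [blochX, pauliX, Matrix.trace, Matrix.mul_apply]
    ring
  rw [renyi, this, Complex.ofReal_re]

theorem renyi_blochX_lt {y z : ℝ} (h : |z| < |y|) : renyi (blochX y) < renyi (blochX z) := by
  rw [renyi_blochX, renyi_blochX, neg_lt_neg_iff]
  have := sq_lt_sq.2 h
  exact Real.logb_lt_logb (by norm_num) (by positivity) (by linarith)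

theorem failure_entropyEst_le {N : ℕ} {ψ : Ket N} {c : List (Block N)} {n : Fin N} {x : ℝ}
    (h : probPlus (blocksOp c *ᵥ ψ) .X n = (1 + x) / 2) {M : ℕ} (hM : 0 < M) {ε : ℝ}
    (hε : 0 < ε) :
    (entropyEst M c n).failure ψ (fun v => ∃ y, |y - x| < ε ∧ v = renyi (blochX y))
      ≤ hoeffdingBound M ε := by
  rw [← add_zero (hoeffdingBound M ε)]
  refine (failure_bind_le ψ _ _ _ _ le_rfl fun s hs => ?_).trans
    (add_le_add_left (failure_outcomeSum_le h hM hε) 0)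
  exact (failure_done ψ ⟨_, hs, rfl⟩).le

/-- The entropy decreases in |x|. Since √2/2 < 3/4, |z| < 3P/4 + r/8 ≤ P - r/8 < y, where the middle
inequality uses r ≤ P. -/
theorem renyi_lt_of_near {P r y z : ℝ} (hr : 0 < r) (hP : r ≤ P) (hy : |y - P| < r / 8)
    (hz : |z - Real.sqrt 2 / 2 * P| < r / 8) : renyi (blochX y) < renyi (blochX z) := by
  apply renyi_blochX_lt
  have h2 := Real.sqrt_two_lt_three_halves
  have h0 := Real.sqrt_nonneg 2
  rw [abs_lt] at hy hz
  refine lt_of_lt_of_le ?_ (le_abs_self y)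
  rw [abs_lt]
  constructor <;> nlinarith

/-! ### Correctness of Step I -/

theorem Reaches.failure_entropyEst_le {N : ℕ} {ψ : Ket N} {c : List (Block N)}
    {R : SimpleGraph (Fin N)} (hr : Reaches ψ c (graphWeight R)) {p q : Fin N} (h : p ≠ q) (θ : ℝ)
    {n : Fin N} {x : ℝ} (hn : n = p ∨ n = q)
    (hx : xMean (graphWeight R + pairWeight p q θ) n = x) {M : ℕ} (hM : 0 < M) {ε : ℝ}
    (hε : 0 < ε) :
    (entropyEst M (c ++ [candidate c p q h θ]) n).failure ψ
      (fun v => ∃ y, |y - x| < ε ∧ v = renyi (blochX y)) ≤ hoeffdingBound M ε := by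
  subst hx
  refine AQER.failure_entropyEst_le ((hr.append_candidate p q h θ).probPlus_eq ?_ n ?_ ?_) hM hε
  · intro a b
    rw [Pi.add_apply, Pi.add_apply, Pi.add_apply, Pi.add_apply, graphWeight_symm,
      pairWeight_symm]
  · have h1 : graphWeight R n n = 0 := by simp [graphWeight]
    have h2 : pairWeight p q θ n n = 0 := by
      unfold pairWeight
      rw [if_neg]
      rintro (⟨rfl, rfl⟩ | ⟨rfl, rfl⟩) <;> exact h rfl
    rw [Pi.add_apply, Pi.add_apply, h1, h2, add_zero]
  · rw [touched_append]
    rcases hn with rfl | rfl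
    · exact Or.inr (Or.inl rfl)
    · exact Or.inr (Or.inr rfl)

theorem Reaches.failure_changeEst_le {N D : ℕ} {ψ : Ket N} {c : List (Block N)}
    {R G : SimpleGraph (Fin N)} [DecidableRel G.Adj] (hr : Reaches ψ c (graphWeight R))
    (hR : R ≤ G) (hD : ∀ n, G.degree n ≤ D) {p q : Fin N} (h : p ≠ q) {M : ℕ} (hM : 0 < M) :
    (changeEst M c p q h).failure ψ (fun v => v < 0 ↔ R.Adj p q)
      ≤ 4 * hoeffdingBound M ((Real.sqrt 2 / 2) ^ D / 8) := by
  have hr0 : (0 : ℝ) < (Real.sqrt 2 / 2) ^ D := by positivity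
  have hP := pow_le_coherence hR hD p q
  have hQ := pow_le_coherence hR hD q p
  generalize (Real.sqrt 2 / 2) ^ D = r at *
  have hε : 0 < r / 8 := by positivity
  set η := hoeffdingBound M (r / 8) with hη
  have hη0 : 0 ≤ η := hoeffdingBound_nonneg _ _
  have hxp : ∀ θ, xMean (graphWeight R + pairWeight p q θ) p
      = Real.cos (graphWeight R p q + θ) * coherence R p q := xMean_add_pairWeight R h
  have hxq : ∀ θ, xMean (graphWeight R + pairWeight p q θ) q
      = Real.cos (graphWeight R p q + θ) * coherence R q p := by
    intro θ
    rw [pairWeight_comm, graphWeight_symm R p q, xMean_add_pairWeight R h.symm]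
  set k₀ := Real.cos (graphWeight R p q + 0) with hk₀
  set k₁ := Real.cos (graphWeight R p q + -(Real.pi / 4)) with hk₁
  have est := fun (θ : ℝ) (n : Fin N) (hn : n = p ∨ n = q) =>
    hr.failure_entropyEst_le h θ hn rfl hM hε
  have e₀ := est 0
  have e₁ := est (-(Real.pi / 4))
  -- The entropies of p and q move in the same direction, so the sign of their summed change is
  -- determined without comparing magnitudes.
  have hfin : ∀ y₀ z₀ y₁ z₁ : ℝ, |y₀ - k₀ * coherence R p q| < r / 8 →
      |z₀ - k₀ * coherence R q p| < r / 8 → |y₁ - k₁ * coherence R p q| < r / 8 →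
      |z₁ - k₁ * coherence R q p| < r / 8 →
      (renyi (blochX y₁) + renyi (blochX z₁) - (renyi (blochX y₀) + renyi (blochX z₀)) < 0
        ↔ R.Adj p q) := by
    intro y₀ z₀ y₁ z₁ hy₀ hz₀ hy₁ hz₁
    by_cases hA : R.Adj p q
    · have h0 : k₀ = Real.sqrt 2 / 2 := by simp [hk₀, graphWeight, hA]
      have h1 : k₁ = 1 := by simp [hk₁, graphWeight, hA]
      rw [h0] at hy₀ hz₀
      rw [h1, one_mul] at hy₁ hz₁
      have a := renyi_lt_of_near hr0 hP hy₁ hy₀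
      have b := renyi_lt_of_near hr0 hQ hz₁ hz₀
      exact iff_of_true (by linarith) hA
    · have h0 : k₀ = 1 := by simp [hk₀, graphWeight, hA]
      have h1 : k₁ = Real.sqrt 2 / 2 := by simp [hk₁, graphWeight, hA]
      rw [h0, one_mul] at hy₀ hz₀
      rw [h1] at hy₁ hz₁
      have a := renyi_lt_of_near hr0 hP hy₀ hy₁
      have b := renyi_lt_of_near hr0 hQ hz₀ hz₁
      exact iff_of_false (by linarith) hA
  have e₀p := e₀ p (Or.inl rfl)
  have e₀q := e₀ q (Or.inr rfl)
  have e₁p := e₁ p (Or.inl rfl)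
  have e₁q := e₁ q (Or.inr rfl)
  rw [hxp] at e₀p e₁p
  rw [hxq] at e₀q e₁q
  -- One summand per entropy estimate; the final 0 belongs to the deterministic last step.
  rw [show 4 * η = η + (η + (η + (η + 0))) by ring, changeEst]
  refine (failure_bind_le ψ _ _ _ _ (by positivity) ?_).trans (add_le_add e₀p le_rfl)
  rintro _ ⟨y₀, hy₀, rfl⟩
  refine (failure_bind_le ψ _ _ _ _ (by positivity) ?_).trans (add_le_add e₀q le_rfl)
  rintro _ ⟨z₀, hz₀, rfl⟩
  refine (failure_bind_le ψ _ _ _ _ (by positivity) ?_).trans (add_le_add e₁p le_rfl)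
  rintro _ ⟨y₁, hy₁, rfl⟩
  refine (failure_bind_le ψ _ _ _ _ le_rfl ?_).trans (add_le_add e₁q le_rfl)
  rintro _ ⟨z₁, hz₁, rfl⟩
  exact (failure_done ψ (hfin y₀ z₀ y₁ z₁ hy₀ hz₀ hy₁ hz₁)).le

/-- The scan of the pairs in `l` finds exactly the edges of `R`. -/
def ScanCorrect {N : ℕ} (c : List (Block N)) (R : SimpleGraph (Fin N)) (l : List (Fin N × Fin N))
    (r : List (Block N × ℝ)) : Prop :=
  (∀ a ∈ r, ∃ (p q : Fin N) (h : p ≠ q),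
    a.1 = candidate c p q h (-(Real.pi / 4)) ∧ (a.2 < 0 ↔ R.Adj p q)) ∧
  ∀ e ∈ l, R.Adj e.1 e.2 → ∃ a ∈ r, a.2 < 0

theorem Reaches.failure_scan_le {N D : ℕ} {ψ : Ket N} {c : List (Block N)}
    {R G : SimpleGraph (Fin N)} [DecidableRel G.Adj] (hr : Reaches ψ c (graphWeight R))
    (hR : R ≤ G) (hD : ∀ n, G.degree n ≤ D) {M : ℕ} (hM : 0 < M) (l : List (Fin N × Fin N)) :
    (scan M c l).failure ψ (ScanCorrect c R l)
      ≤ l.length * (4 * hoeffdingBound M ((Real.sqrt 2 / 2) ^ D / 8)) := by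
  have hη := hoeffdingBound_nonneg M ((Real.sqrt 2 / 2) ^ D / 8)
  induction l with
  | nil =>
    rw [scan, failure_done ψ ⟨by simp, by simp⟩]
    simp
  | cons e l ih =>
    have hlen : ((e :: l).length : ℝ) * (4 * hoeffdingBound M ((Real.sqrt 2 / 2) ^ D / 8))
        = 4 * hoeffdingBound M ((Real.sqrt 2 / 2) ^ D / 8)
          + (l.length * (4 * hoeffdingBound M ((Real.sqrt 2 / 2) ^ D / 8)) + 0) := by
      rw [List.length_cons]
      push_cast
      ring
    rw [hlen, scan]
    split_ifs with h
    · refine (failure_bind_le ψ _ _ _ _ (by positivity) fun v hv => ?_).trans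
        (add_le_add (hr.failure_changeEst_le hR hD h hM) le_rfl)
      refine (failure_bind_le ψ _ _ _ _ le_rfl fun r hc => ?_).trans (add_le_add ih le_rfl)
      refine (failure_done ψ ⟨?_, ?_⟩).le
      · intro a ha
        rcases List.mem_cons.1 ha with rfl | ha
        · exact ⟨e.1, e.2, h, rfl, hv⟩
        · exact hc.1 a ha
      · intro e' he' hadj
        rcases List.mem_cons.1 he' with rfl | he'
        · exact ⟨_, List.mem_cons_self, hv.2 hadj⟩
        · obtain ⟨a, ha, h0⟩ := hc.2 e' he' hadj
          exact ⟨a, List.mem_cons_of_mem _ ha, h0⟩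
    · refine (failure_mono ψ (fun r hc => ⟨hc.1, ?_⟩) _).trans (ih.trans (by linarith))
      intro e' he' hadj
      rcases List.mem_cons.1 he' with rfl | he'
      · exact absurd hadj.ne h
      · exact hc.2 e' he' hadj

theorem graphWeight_eq_zero {N : ℕ} {R : SimpleGraph (Fin N)} (h : R.edgeSet.ncard = 0) :
    graphWeight R = 0 := by
  rw [Set.ncard_eq_zero (Set.toFinite _), SimpleGraph.edgeSet_eq_empty] at h
  subst h
  ext a b
  simp [graphWeight]

/-- Induction on the budget, with the remaining graph R as loop invariant. The factor |R| + 1 counts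
one scan per remaining edge and a last one confirming that none is left. That last scan is absent
when the budget runs out at the same moment. -/
theorem Reaches.failure_stepI_le {N D : ℕ} {ψ : Ket N} {G : SimpleGraph (Fin N)}
    [DecidableRel G.Adj] (hD : ∀ n, G.degree n ≤ D) {M : ℕ} (hM : 0 < M) (k : ℕ)
    {c : List (Block N)} {R : SimpleGraph (Fin N)} (hR : R ≤ G)
    (hr : Reaches ψ c (graphWeight R)) (hk : R.edgeSet.ncard ≤ k) :
    (stepI M k c).failure ψ
        (fun c' => Reaches ψ c' 0 ∧ c'.length = c.length + R.edgeSet.ncard)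
      ≤ (R.edgeSet.ncard + 1)
        * ((pairs N).length * (4 * hoeffdingBound M ((Real.sqrt 2 / 2) ^ D / 8))) := by
  have hη := hoeffdingBound_nonneg M ((Real.sqrt 2 / 2) ^ D / 8)
  have hscan := fun (c : List (Block N)) (R : SimpleGraph (Fin N)) (hR : R ≤ G)
    (hr : Reaches ψ c (graphWeight R)) => hr.failure_scan_le hR hD hM (pairs N)
  generalize hF : ((pairs N).length : ℝ)
    * (4 * hoeffdingBound M ((Real.sqrt 2 / 2) ^ D / 8)) = F at *
  have hF0 : 0 ≤ F := by rw [← hF]; positivity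
  induction k generalizing c R with
  | zero =>
    have h0 : R.edgeSet.ncard = 0 := by omega
    rw [graphWeight_eq_zero h0] at hr
    rw [stepI, failure_done ψ ⟨hr, by rw [h0, add_zero]⟩]
    positivity
  | succ k ih =>
    rw [stepI, add_one_mul, add_comm _ F]
    refine (failure_bind_le ψ _ _ _ _ (by positivity) fun r hc => ?_).trans
      (add_le_add (hscan c R hR hr) le_rfl)
    have hdone : (∀ a ∈ r, ¬ a.2 < 0) → (.done c : CopyAlg N _).failure ψ
        (fun c' => Reaches ψ c' 0 ∧ c'.length = c.length + R.edgeSet.ncard)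
        ≤ R.edgeSet.ncard * F := by
      intro hneg
      -- A correct scan shows a negative change as soon as R has an edge, so no negative change
      -- means that R is empty.
      have hbot : R = ⊥ := by
        ext a b
        simp only [SimpleGraph.bot_adj, iff_false]
        intro hab
        have hex : ∃ a ∈ r, a.2 < 0 := by
          rcases lt_or_gt_of_ne hab.ne with h | h
          · exact hc.2 (a, b) ((mem_pairs _).2 h) hab
          · exact hc.2 (b, a) ((mem_pairs _).2 h) hab.symm
        obtain ⟨a, ha, h0⟩ := hex
        exact hneg a ha h0
      have h0 : R.edgeSet.ncard = 0 := by simp [hbot]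
      rw [graphWeight_eq_zero h0] at hr
      rw [failure_done ψ ⟨hr, by rw [h0, add_zero]⟩]
      positivity
    cases hm : r.argmin Prod.snd with
    | none =>
      rw [List.argmin_eq_none] at hm
      subst hm
      exact hdone (by simp)
    | some bv =>
      obtain ⟨b, v⟩ := bv
      dsimp only
      split_ifs with hv
      -- Which edge attains the minimum is irrelevant: a negative estimate already certifies an edge
      -- of R, and the appended block deletes it.
      · obtain ⟨p, q, h, hb, hadj⟩ := hc.1 _ (List.argmin_mem hm)
        have hA := hadj.1 hv
        simp only at hb
        have hcard : (R.deleteEdges {s(p, q)}).edgeSet.ncard + 1 = R.edgeSet.ncard := by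
          rw [SimpleGraph.edgeSet_deleteEdges]
          exact Set.ncard_sdiff_singleton_add_one ((SimpleGraph.mem_edgeSet R).2 hA)
            (Set.toFinite _)
        have hr' : Reaches ψ (c ++ [b]) (graphWeight (R.deleteEdges {s(p, q)})) := by
          rw [hb, ← graphWeight_deleteEdge R hA]
          exact hr.append_candidate p q h _
        have key := ih ((SimpleGraph.deleteEdges_le _).trans hR) hr' (by omega)
        have hcast : ((R.deleteEdges {s(p, q)}).edgeSet.ncard : ℝ) + 1 = R.edgeSet.ncard := by
          exact_mod_cast hcard
        rw [hcast] at key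
        refine (failure_mono ψ (fun c' h' => ⟨h'.1, ?_⟩) _).trans key
        rw [h'.2, List.length_append, List.length_singleton]
        omega
      · refine hdone fun a ha h0 => hv ?_
        exact lt_of_le_of_lt (List.le_of_mem_argmin ha hm) h0

/-! ### The number of shots -/

/-- The number of shots per estimate. -/
def shots (N D : ℕ) (δ : ℝ) : ℕ := ⌈512 * (2 ^ D * Real.log ((N : ℝ) ^ 2 / δ))⌉₊

theorem one_le_log {N : ℕ} (hN : 2 ≤ N) {δ : ℝ} (h0 : 0 < δ) (h1 : δ < 1) :
    1 ≤ Real.log ((N : ℝ) ^ 2 / δ) := by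
  have hN' : (2 : ℝ) ≤ N := by exact_mod_cast hN
  rw [Real.le_log_iff_exp_le (by positivity), le_div_iff₀ h0]
  have := Real.exp_one_lt_d9
  nlinarith [Real.exp_pos 1]

/-- The rounding up costs at most 1, which is absorbed because 2^D log(N²/δ) ≥ 1; hence 513 instead
of 512. -/
theorem shots_le {N : ℕ} (D : ℕ) (hN : 2 ≤ N) {δ : ℝ} (h0 : 0 < δ) (h1 : δ < 1) :
    (shots N D δ : ℝ) ≤ 513 * (2 ^ D * Real.log ((N : ℝ) ^ 2 / δ)) := by
  have hl := one_le_log hN h0 h1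
  have hD : (1 : ℝ) ≤ 2 ^ D := one_le_pow₀ (by norm_num)
  have := (Nat.ceil_lt_add_one (a := 512 * (2 ^ D * Real.log ((N : ℝ) ^ 2 / δ)))
    (by positivity)).le
  unfold shots
  nlinarith

theorem shots_pos {N : ℕ} (D : ℕ) (hN : 2 ≤ N) {δ : ℝ} (h0 : 0 < δ) (h1 : δ < 1) :
    0 < shots N D δ := by
  have hl := one_le_log hN h0 h1
  exact Nat.ceil_pos.2 (by positivity)

/-- With ε = (√2/2)^D/8 one has ε²/2 = 2^(-D)/128. The constant 512 = 4·128 makes the exponential at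
most (δ/N²)^4, so the left side is at most 8δ^4/N^4 ≤ δ. -/
theorem hoeffdingBound_shots_le {N : ℕ} (D : ℕ) (hN : 2 ≤ N) {δ : ℝ} (h0 : 0 < δ) (h1 : δ < 1) :
    (N : ℝ) ^ 4 * (4 * hoeffdingBound (shots N D δ) ((Real.sqrt 2 / 2) ^ D / 8)) ≤ δ := by
  have hN' : (2 : ℝ) ≤ N := by exact_mod_cast hN
  have hM : 512 * (2 ^ D * Real.log ((N : ℝ) ^ 2 / δ)) ≤ shots N D δ := Nat.le_ceil _
  have hsq : ((Real.sqrt 2 / 2) ^ D / 8) ^ 2 / 2 = (1 / 2) ^ D / 128 := by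
    rw [div_pow, ← pow_mul, mul_comm D 2, pow_mul, div_pow, Real.sq_sqrt (by norm_num)]
    norm_num
    ring
  have hexp : 4 * Real.log ((N : ℝ) ^ 2 / δ) ≤ shots N D δ * ((1 / 2) ^ D / 128) := by
    calc 4 * Real.log ((N : ℝ) ^ 2 / δ)
        = 512 * (2 ^ D * Real.log ((N : ℝ) ^ 2 / δ)) * ((1 / 2) ^ D / 128) := by
          have : (2 : ℝ) ^ D * (1 / 2) ^ D = 1 := by rw [← mul_pow]; norm_num
          linear_combination (-4 * Real.log ((N : ℝ) ^ 2 / δ)) * this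
      _ ≤ _ := by gcongr
  have hle : Real.exp (-(shots N D δ * ((1 / 2) ^ D / 128))) ≤ (δ / (N : ℝ) ^ 2) ^ 4 := by
    calc _ ≤ Real.exp (-(4 * Real.log ((N : ℝ) ^ 2 / δ))) := by
          rw [Real.exp_le_exp]
          linarith
      _ = (δ / (N : ℝ) ^ 2) ^ 4 := by
          rw [← mul_neg, ← Real.log_inv, inv_div, mul_comm, ← Real.rpow_def_of_pos (by positivity)]
          exact_mod_cast Real.rpow_natCast _ 4
  unfold hoeffdingBound
  rw [hsq]
  calc (N : ℝ) ^ 4 * (4 * (2 * Real.exp (-(shots N D δ * ((1 / 2) ^ D / 128)))))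
      ≤ (N : ℝ) ^ 4 * (4 * (2 * (δ / (N : ℝ) ^ 2) ^ 4)) := by gcongr
    _ = 8 * δ ^ 3 / (N : ℝ) ^ 4 * δ := by
        field_simp
        ring
    _ ≤ 1 * δ := by
        gcongr
        rw [div_le_one (by positivity)]
        have h3 : δ ^ 3 ≤ 1 := pow_le_one₀ h0.le h1.le
        have h4 : (2 : ℝ) ^ 4 ≤ (N : ℝ) ^ 4 := by gcongr
        linarith
    _ = δ := one_mul δ

theorem ncard_edgeSet_add_one_le {N : ℕ} (hN : 2 ≤ N) (G : SimpleGraph (Fin N))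
    [DecidableRel G.Adj] : G.edgeFinset.card + 1 ≤ N ^ 2 := by
  have h := G.card_edgeFinset_le_card_choose_two
  rw [Fintype.card_fin, Nat.choose_two_right] at h
  have h2 : N * (N - 1) / 2 ≤ N * (N - 1) := Nat.div_le_self _ _
  obtain ⟨m, rfl⟩ : ∃ m, N = m + 2 := ⟨N - 2, by omega⟩
  simp only [show m + 2 - 1 = m + 1 by omega] at h h2
  nlinarith

/-! ### Cost and success probability of the whole algorithm -/

theorem allRuns_aqer (N M B : ℕ) :
    AllRuns (fun L n => L.blocks.length ≤ B ∧ n ≤ 4 * M * (pairs N).length * B ∧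
      n ≤ 4 * M * (pairs N).length * (L.blocks.length + 1)) (aqer N M B) :=
  (allRuns_stepI M B []).bind fun c n hc => by
    have : c.length ≤ B ∧ n + 0 ≤ 4 * M * (pairs N).length * B ∧
      n + 0 ≤ 4 * M * (pairs N).length * (c.length + 1) := by simpa using hc
    exact this

/-- Here k counts scans. The slack k ≤ 2m covers both uses: |E| + 1 ≤ 2|E| scans in a successful
run, and at most B scans in any run. The constant is 4104 = 4·513·2. -/
theorem cost_le {N D M n k m : ℕ} {δ : ℝ} (h0 : 0 < δ)
    (hN : 2 ≤ N) (hM : (M : ℝ) ≤ 513 * (2 ^ D * Real.log ((N : ℝ) ^ 2 / δ)))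
    (hn : n ≤ 4 * M * (pairs N).length * k) (hm : 1 ≤ m) (hk : k ≤ 2 * m) :
    (n : ℝ) ≤ 4104 * ((m : ℝ) * (N : ℝ) ^ 2 * 2 ^ D * Real.log ((N : ℝ) ^ 2 * m / δ)) := by
  have hN' : (2 : ℝ) ≤ N := by exact_mod_cast hN
  have hm' : (1 : ℝ) ≤ m := by exact_mod_cast hm
  have hk' : (k : ℝ) ≤ 2 * m := by exact_mod_cast hk
  have hp : ((pairs N).length : ℝ) ≤ (N : ℝ) ^ 2 := by exact_mod_cast length_pairs_le N
  have hlog : Real.log ((N : ℝ) ^ 2 / δ) ≤ Real.log ((N : ℝ) ^ 2 * m / δ) := by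
    apply Real.log_le_log (by positivity)
    gcongr
    exact le_mul_of_one_le_right (by positivity) hm'
  calc (n : ℝ) ≤ 4 * M * (pairs N).length * k := by exact_mod_cast hn
    _ ≤ 4 * (513 * (2 ^ D * Real.log ((N : ℝ) ^ 2 * m / δ))) * (N : ℝ) ^ 2 * (2 * m) := by
        have hM' := hM.trans (by gcongr : _ ≤ 513 * (2 ^ D * Real.log ((N : ℝ) ^ 2 * m / δ)))
        have hK := (Nat.cast_nonneg M).trans hM'
        generalize 513 * (2 ^ D * Real.log ((N : ℝ) ^ 2 * m / δ)) = K at *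
        gcongr
    _ = _ := by ring

theorem failure_aqer_le {N D : ℕ} (hN : 2 ≤ N) {δ : ℝ} (h0 : 0 < δ) (h1 : δ < 1) (B : ℕ)
    (G : SimpleGraph (Fin N)) [DecidableRel G.Adj] (hD : ∀ n, G.degree n ≤ D)
    (hB : G.edgeFinset.card ≤ B) :
    (aqer N (shots N D δ) B).failure (iqpState G) (fun L => L.LoadsExactly (iqpState G) ∧
      L.blocks.length = G.edgeFinset.card) ≤ δ := by
  have hcard : G.edgeSet.ncard = G.edgeFinset.card := by
    rw [← SimpleGraph.coe_edgeFinset, Set.ncard_coe_finset]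
  have hη := hoeffdingBound_nonneg (shots N D δ) ((Real.sqrt 2 / 2) ^ D / 8)
  rw [aqer]
  refine le_of_le_of_eq ?_ (add_zero δ)
  refine (failure_bind_le _ _ _ _ _ le_rfl fun c hc => ?_).trans (add_le_add
    ((Reaches.failure_stepI_le hD (shots_pos D hN h0 h1) B le_rfl (reaches_nil G)
      (hcard.trans_le hB)).trans ?_) le_rfl)
  · refine (failure_done _ ⟨hc.1.loadsExactly, ?_⟩).le
    rw [hc.2, hcard, List.length_nil, zero_add]
  · refine le_trans ?_ (hoeffdingBound_shots_le D hN h0 h1)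
    rw [hcard, ← mul_assoc]
    refine mul_le_mul_of_nonneg_right ?_ (by positivity)
    -- Bounding the number of scans by N² rather than by |E| + 1 lets the number of shots be chosen
    -- without knowing |E|.
    have hE : ((G.edgeFinset.card + 1 : ℕ) : ℝ) ≤ (N ^ 2 : ℕ) := by
      exact_mod_cast ncard_edgeSet_add_one_le hN G
    have hp : ((pairs N).length : ℝ) ≤ (N : ℝ) ^ 2 := by exact_mod_cast length_pairs_le N
    push_cast at hE
    calc _ ≤ (N : ℝ) ^ 2 * (N : ℝ) ^ 2 := by gcongr
      _ = (N : ℝ) ^ 4 := by ring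

end AQER

end

theorem mainTheorem7 :
    ∃ C : ℝ, 0 < C ∧
      ∀ (N D : ℕ) (δ : ℝ), 2 ≤ N → 0 < δ → δ < 1 →
        ∃ M : ℕ, ∀ (B : ℕ) (G : SimpleGraph (Fin N)) [DecidableRel G.Adj],
          (∀ n, G.degree n ≤ D) → 1 ≤ G.edgeFinset.card → G.edgeFinset.card ≤ B →
            (ENNReal.ofReal (1 - δ) ≤
              ((AQER.aqer N M B).run (AQER.iqpState G)).toOuterMeasure
                {r | r.1.LoadsExactly (AQER.iqpState G) ∧
                  r.1.blocks.length ≤ G.edgeFinset.card ∧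
                  (r.2 : ℝ) ≤ C * ((G.edgeFinset.card : ℝ) * (N : ℝ) ^ 2 * 2 ^ D *
                    Real.log ((N : ℝ) ^ 2 * G.edgeFinset.card / δ))}) ∧
            (∀ r ∈ ((AQER.aqer N M B).run (AQER.iqpState G)).support,
              r.1.blocks.length ≤ B ∧
              (r.2 : ℝ) ≤ C * ((B : ℝ) * (N : ℝ) ^ 2 * 2 ^ D *
                Real.log ((N : ℝ) ^ 2 * B / δ))) := by
  refine ⟨4104, by norm_num, fun N D δ hN h0 h1 => ⟨AQER.shots N D δ, ?_⟩⟩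
  intro B G _ hD hE hB
  have hM := AQER.shots_le D hN h0 h1
  have hrun := fun r hr => (AQER.allRuns_aqer N (AQER.shots N D δ) B).of_mem_support
    (AQER.iqpState G) (r := r) hr
  constructor
  · calc ENNReal.ofReal (1 - δ)
        ≤ _ := ENNReal.ofReal_le_ofReal
          (sub_le_sub_left (AQER.failure_aqer_le hN h0 h1 B G hD hB) 1)
      _ = _ := (AQER.CopyAlg.toOuterMeasure_run _ _ _).symm
      _ ≤ _ := by
        -- Only outcomes in the support need to be compared. There the deterministic cost bound
        -- applies, and the exact block count |E| turns it into the stated one.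
        refine PMF.toOuterMeasure_mono _ ?_
        rintro r ⟨⟨hload, hlen⟩, hr⟩
        have hcost := (hrun r hr).2.2
        rw [hlen] at hcost
        exact ⟨hload, hlen.le, AQER.cost_le h0 hN hM hcost hE (by omega)⟩
  · intro r hr
    exact ⟨(hrun r hr).1, AQER.cost_le h0 hN hM (hrun r hr).2.1 (hE.trans hB) (by omega)⟩
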